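/- An $n$-precategory ($n\in\mathbb N\cup\{\omega\}$) is an $n$-globular set $C$ (sets $C_k$ for $k\le n$, with source and target maps $\partial^-,\partial^+\colon C_{k+1}\to C_k$ satisfying $\partial^\epsilon\partial^-=\partial^\epsilon\partial^+$ for $\epsilon\in\{-,+\}$; $\partial^\epsilon_i$ denotes the iterated source or target in $C_i$) equipped with identities $\mathrm{id}\colon C_k\to C_{k+1}$ for $k<n$ and compositions $u\bullet_i v\in C_{\max(k,l)}$ for $u\in C_k$, $v\in C_l$ with $k,l\ge 1$, $i=\min(k,l)-1$ and $\partial^+_i(u)=\partial^-_i(v)$ (we then say that $u,v$ are $i$-composable), satisfying, whenever the expressions are defined: (1) $\partial^\epsilon(\mathrm{id}_u)=u$; (2) $\partial^\epsilon(u\bullet_i v)$ equals $u\bullet_i\partial^\epsilon(v)$ if $k<l$, equals $\partial^\epsilon(u)\bullet_i v$ if $k>l$, and, if $k=l$, equals $\partial^-(u)$ for $\epsilon=-$ and $\partial^+(v)$ for $\epsilon=+$; (3) $\mathrm{id}_u\bullet_i v$ is $v$ if $\dim \mathrm{id}_u\le\dim v$ and $\mathrm{id}_{u\bullet_i v}$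 otherwise; $u\bullet_i\mathrm{id}_v$ is $u$ if $\dim\mathrm{id}_v\le\dim u$ and $\mathrm{id}_{u\bullet_i v}$ otherwise; (4) $(u\bullet_i v)\bullet_i w=u\bullet_i(v\bullet_i w)$; (5) for $i<j$, $u\bullet_i(v\bullet_j v')=(u\bullet_i v)\bullet_j(u\bullet_i v')$ and $(u\bullet_j u')\bullet_i v=(u\bullet_i v)\bullet_j(u'\bullet_i v)$. No interchange law is required. Polygraphs, and the precategories they freely generate, are defined by induction: a $0$-polygraph is a set $\mathsf P$, and $\mathsf P^*=\mathsf P$; an $(n+1)$-polygraph consists of an $n$-polygraph $\mathsf P$ and a set of $(n+1)$-generators, each with a source and a target in $\mathsf P^*_n$ that satisfy the globular identities, and its free $(n+1)$-precategory is obtained from the $n$-precategory $\mathsf P^*$ by freely adjoining these generators as $(n+1)$-cells. An $\omega$-polygraph $\mathsf P$ is a sequence $(\mathsf P_{\le n})_{n\in\mathbb N}$ of $n$-polygraphs such that $\mathsf P_{\le n}$ is the underlying $n$-polygraph of $\mathsf P_{\le n+1}$, and its free $\omega$-precategory $\mathsf P^*$ is the union of the $(\mathsf P_{\le n})^*$.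 **Proposition.** Let $\mathsf P$ be an $\omega$-polygraph, let $i\in\mathbb N$, and let $u,v_1,v_2$ be cells of $\mathsf P^*$ (of any dimensions) such that $u,v_1$ are $i$-composable and $u,v_2$ are $i$-composable. If $u\bullet_i v_1=u\bullet_i v_2$ in $\mathsf P^*$, then $v_1=v_2$. -/

import Mathlib

universe u

/-- A globular set, as the graded set of all its globes: `dim` gives the dimension of a globe,
`bd false` is the source and `bd true` the target of a globe of positive dimension.
By convention `bd ε x = x` when `x` has dimension `0`. -/
structure GlobularSet where
  Cell : Type u
  dim : Cell → ℕ
  bd : Bool → Cell → Cell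
  dim_bd : ∀ ε x, dim (bd ε x) = dim x - 1
  bd_zero : ∀ ε x, dim x = 0 → bd ε x = x
  globular : ∀ ε x, 2 ≤ dim x → bd ε (bd false x) = bd ε (bd true x)

namespace GlobularSet

variable (G : GlobularSet.{u})

/-- The iterated source (`ε = false`) or target (`ε = true`) of dimension `i ≤ dim x`. -/
def bdTo (ε : Bool) (i : ℕ) (x : G.Cell) : G.Cell := (G.bd ε)^[G.dim x - i] x

/-- `x` and `y` form an element of `G_k ×_i G_l` with `i = min k l - 1`. -/
def Composable (i : ℕ) (x y : G.Cell) : Prop :=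
  min (G.dim x) (G.dim y) = i + 1 ∧ G.bdTo true i x = G.bdTo false i y

theorem bdTo_of_lt {ε : Bool} {i : ℕ} {x : G.Cell} (h : i < G.dim x) :
    G.bdTo ε i x = G.bdTo ε i (G.bd ε x) := by
  unfold bdTo
  rw [G.dim_bd, ← Function.iterate_succ_apply]
  congr 1
  omega

theorem bdTo_self {ε : Bool} {i : ℕ} {x : G.Cell} (h : G.dim x ≤ i) :
    G.bdTo ε i x = x := by
  unfold bdTo
  rw [Nat.sub_eq_zero_of_le h]
  rfl

theorem bd_bd (ε η : Bool) {x : G.Cell} (h : 2 ≤ G.dim x) :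
    G.bd ε (G.bd η x) = G.bd ε (G.bd ε x) := by
  have := G.globular ε x h
  cases ε <;> cases η <;> simp_all

theorem bdTo_bd {ε η : Bool} {i : ℕ} {x : G.Cell} (h : i + 1 < G.dim x) :
    G.bdTo ε i (G.bd η x) = G.bdTo ε i x := by
  rw [G.bdTo_of_lt (x := x) (by omega), G.bdTo_of_lt (x := G.bd η x) (by rw [G.dim_bd]; omega),
    G.bdTo_of_lt (x := G.bd ε x) (by rw [G.dim_bd]; omega), G.bd_bd ε η (by omega)]

end GlobularSet

/-- An `n`-precategory, for `n ∈ ℕ ∪ {ω}`. The operation `one` is meaningful on cells of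
dimension `< n`, and `comp i` on `i`-composable pairs; their other values are irrelevant. -/
structure Precategory (n : ℕ∞) extends GlobularSet.{u} where
  dim_le : ∀ x, (dim x : ℕ∞) ≤ n
  one : Cell → Cell
  comp : ℕ → Cell → Cell → Cell
  dim_one : ∀ x, (dim x : ℕ∞) < n → dim (one x) = dim x + 1
  dim_comp : ∀ i x y, toGlobularSet.Composable i x y → dim (comp i x y) = max (dim x) (dim y)
  -- boundaries of identities
  bd_one : ∀ ε x, (dim x : ℕ∞) < n → bd ε (one x) = x
  -- boundaries of composites
  bd_comp_lt : ∀ ε i x y, toGlobularSet.Composable i x y → dim x < dim y →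
    bd ε (comp i x y) = comp i x (bd ε y)
  src_comp : ∀ i x y, toGlobularSet.Composable i x y → dim x = dim y →
    bd false (comp i x y) = bd false x
  tgt_comp : ∀ i x y, toGlobularSet.Composable i x y → dim x = dim y →
    bd true (comp i x y) = bd true y
  bd_comp_gt : ∀ ε i x y, toGlobularSet.Composable i x y → dim y < dim x →
    bd ε (comp i x y) = comp i (bd ε x) y
  -- composition with identities
  one_comp_le : ∀ i x y, (dim x : ℕ∞) < n → toGlobularSet.Composable i (one x) y →
    dim x + 1 ≤ dim y → comp i (one x) y = y
  one_comp_gt : ∀ i x y, (dim x : ℕ∞) < n → toGlobularSet.Composable i x y →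
    dim y < dim x + 1 → comp i (one x) y = one (comp i x y)
  comp_one_le : ∀ i x y, (dim y : ℕ∞) < n → toGlobularSet.Composable i x (one y) →
    dim y + 1 ≤ dim x → comp i x (one y) = x
  comp_one_gt : ∀ i x y, (dim y : ℕ∞) < n → toGlobularSet.Composable i x y →
    dim x < dim y + 1 → comp i x (one y) = one (comp i x y)
  -- associativity (the dimension condition says that both sides are defined)
  assoc : ∀ i x y z, toGlobularSet.Composable i x y → toGlobularSet.Composable i y z →
    min (dim x) (dim z) = i + 1 → comp i (comp i x y) z = comp i x (comp i y z)
  -- distributivity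
  comp_distrib : ∀ i j x y y', i < j → toGlobularSet.Composable i x y →
    toGlobularSet.Composable j y y' →
    comp i x (comp j y y') = comp j (comp i x y) (comp i x y')
  distrib_comp : ∀ i j x x' y, i < j → toGlobularSet.Composable i x y →
    toGlobularSet.Composable j x x' →
    comp i (comp j x x') y = comp j (comp i x y) (comp i x' y)

namespace Precategory

variable {n : ℕ∞} (C : Precategory.{u} n)

theorem bdTo_comp_high_left {ε : Bool} {i j : ℕ} (hij : i < j) : ∀ (d : ℕ) {x y : C.Cell},
    C.dim y = j + d → C.dim x = i + 1 → C.Composable i x y →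
    C.bdTo ε j (C.comp i x y) = C.comp i x (C.bdTo ε j y) := by
  intro d
  induction d with
  | zero =>
    intro x y hy hx h
    rw [C.bdTo_self (x := y) (by omega), C.bdTo_self]
    rw [C.dim_comp _ _ _ h]; omega
  | succ d ih =>
    intro x y hy hx h
    rw [C.bdTo_of_lt (x := y) (by omega), C.bdTo_of_lt (by rw [C.dim_comp _ _ _ h]; omega),
      C.bd_comp_lt _ _ _ _ h (by omega)]
    have hd : C.dim (C.bd ε y) = j + d := by rw [C.dim_bd]; omega
    refine ih hd hx ⟨by omega, ?_⟩
    rw [C.bdTo_bd (by omega)]; exact h.2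

theorem bdTo_comp_high_right {ε : Bool} {i j : ℕ} (hij : i < j) : ∀ (d : ℕ) {x y : C.Cell},
    C.dim x = j + d → C.dim y = i + 1 → C.Composable i x y →
    C.bdTo ε j (C.comp i x y) = C.comp i (C.bdTo ε j x) y := by
  intro d
  induction d with
  | zero =>
    intro x y hy hx h
    rw [C.bdTo_self (x := x) (by omega), C.bdTo_self]
    rw [C.dim_comp _ _ _ h]; omega
  | succ d ih =>
    intro x y hy hx h
    rw [C.bdTo_of_lt (x := x) (by omega), C.bdTo_of_lt (by rw [C.dim_comp _ _ _ h]; omega),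
      C.bd_comp_gt _ _ _ _ h (by omega)]
    have hd : C.dim (C.bd ε x) = j + d := by rw [C.dim_bd]; omega
    refine ih hd hx ⟨by omega, ?_⟩
    rw [C.bdTo_bd (by omega)]; exact h.2

theorem composable_bd_right {ε : Bool} {i : ℕ} {x y : C.Cell} (h : C.Composable i x y)
    (hd : C.dim x < C.dim y) : C.Composable i x (C.bd ε y) := by
  obtain ⟨h1, h2⟩ := h
  refine ⟨by rw [C.dim_bd]; omega, ?_⟩
  rw [C.bdTo_bd (by omega)]; exact h2

theorem composable_bd_left {ε : Bool} {i : ℕ} {x y : C.Cell} (h : C.Composable i x y)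
    (hd : C.dim y < C.dim x) : C.Composable i (C.bd ε x) y := by
  obtain ⟨h1, h2⟩ := h
  refine ⟨by rw [C.dim_bd]; omega, ?_⟩
  rw [C.bdTo_bd (by omega)]; exact h2

theorem bdTo_comp_same {i : ℕ} : ∀ (d : ℕ) {x y : C.Cell},
    max (C.dim x) (C.dim y) = i + 1 + d → C.Composable i x y →
    C.bdTo false i (C.comp i x y) = C.bdTo false i x ∧
    C.bdTo true i (C.comp i x y) = C.bdTo true i y := by
  intro d
  induction d with
  | zero =>
    intro x y hm h
    have h1 := h.1
    have hc := C.dim_comp _ _ _ h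
    rw [C.bdTo_of_lt (x := C.comp i x y) (by omega), C.bdTo_of_lt (x := C.comp i x y) (by omega),
      C.src_comp _ _ _ h (by omega), C.tgt_comp _ _ _ h (by omega),
      ← C.bdTo_of_lt (by omega), ← C.bdTo_of_lt (by omega)]
    exact ⟨rfl, rfl⟩
  | succ d ih =>
    intro x y hm h
    have h1 := h.1
    have hc := C.dim_comp _ _ _ h
    rw [C.bdTo_of_lt (x := C.comp i x y) (by omega), C.bdTo_of_lt (x := C.comp i x y) (by omega)]
    rcases lt_trichotomy (C.dim x) (C.dim y) with hlt | heq | hgt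
    · rw [C.bd_comp_lt _ _ _ _ h hlt, C.bd_comp_lt _ _ _ _ h hlt]
      rw [(ih (by rw [C.dim_bd]; omega) (C.composable_bd_right h hlt)).1,
        (ih (by rw [C.dim_bd]; omega) (C.composable_bd_right h hlt)).2, C.bdTo_bd (by omega)]
      exact ⟨rfl, rfl⟩
    · omega
    · rw [C.bd_comp_gt _ _ _ _ h hgt, C.bd_comp_gt _ _ _ _ h hgt]
      rw [(ih (by rw [C.dim_bd]; omega) (C.composable_bd_left h hgt)).1,
        (ih (by rw [C.dim_bd]; omega) (C.composable_bd_left h hgt)).2, C.bdTo_bd (by omega)]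
      exact ⟨rfl, rfl⟩

theorem bdTo_false_comp {i : ℕ} {x y : C.Cell} (h : C.Composable i x y) :
    C.bdTo false i (C.comp i x y) = C.bdTo false i x :=
  (C.bdTo_comp_same (max (C.dim x) (C.dim y) - (i + 1)) (by have := h.1; omega) h).1

theorem bdTo_true_comp {i : ℕ} {x y : C.Cell} (h : C.Composable i x y) :
    C.bdTo true i (C.comp i x y) = C.bdTo true i y :=
  (C.bdTo_comp_same (max (C.dim x) (C.dim y) - (i + 1)) (by have := h.1; omega) h).2

theorem bdTo_bdTo {ε η : Bool} {i j : ℕ} (hij : i < j) : ∀ (d : ℕ) {x : C.Cell},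
    C.dim x = j + d → C.bdTo ε i (C.bdTo η j x) = C.bdTo ε i x := by
  intro d
  induction d with
  | zero => intro x hx; rw [C.bdTo_self (x := x) (by omega)]
  | succ d ih =>
    intro x hx
    rw [C.bdTo_of_lt (i := j) (by omega), ih (by rw [C.dim_bd]; omega), C.bdTo_bd (by omega)]

theorem bdTo_low {ε : Bool} {i j : ℕ} (hij : i < j) {x y : C.Cell} (h : C.Composable j x y) :
    C.bdTo ε i x = C.bdTo ε i y ∧ C.bdTo ε i (C.comp j x y) = C.bdTo ε i x := by
  have h1 := h.1
  have hc := C.dim_comp _ _ _ h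
  constructor
  · rw [← C.bdTo_bdTo (η := true) hij (C.dim x - j) (x := x) (by omega),
      ← C.bdTo_bdTo (η := false) hij (C.dim y - j) (x := y) (by omega), h.2]
  · rw [← C.bdTo_bdTo (η := false) hij (C.dim x - j) (x := x) (by omega),
      ← C.bdTo_bdTo (η := false) hij (C.dim (C.comp j x y) - j) (x := C.comp j x y) (by omega),
      C.bdTo_false_comp h]

end Precategory

/-- A set of `(n+1)`-generators on an `n`-precategory: a set together with source and target maps
into the `n`-cells, satisfying the globular identities. -/
structure CellExtension {n : ℕ} (C : Precategory.{u} n) where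
  Gen : Type u
  bd : Bool → Gen → C.Cell
  dim_bd : ∀ ε g, C.dim (bd ε g) = n
  globular : ∀ ε g, 0 < n → C.bd ε (bd false g) = C.bd ε (bd true g)

namespace CellExtension

variable {n : ℕ} {C : Precategory.{u} n} (X : CellExtension C)

/-- Formal composites of `(n+1)`-generators and identities, indexed by source and target. -/
inductive Term : C.Cell → C.Cell → Type u
  | gen (g : X.Gen) : Term (X.bd false g) (X.bd true g)
  | one (a : C.Cell) (ha : C.dim a = n) : Term a a
  | comp {a b c : C.Cell} (f : Term a b) (g : Term b c) : Term a c
  | lcomp {a b : C.Cell} (i : ℕ) (x : C.Cell) (hx : C.Composable i x a) (f : Term a b) :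
      Term (C.comp i x a) (C.comp i x b)
  | rcomp {a b : C.Cell} (i : ℕ) (f : Term a b) (y : C.Cell) (hy : C.Composable i a y) :
      Term (C.comp i a y) (C.comp i b y)

open Term in
/-- The congruence generated by the axioms of precategories whose sides have dimension `n+1`. -/
inductive Rel : ∀ {a b a' b' : C.Cell}, X.Term a b → X.Term a' b' → Prop
  | refl {a b} (f : X.Term a b) : Rel f f
  | symm {a b a' b'} {f : X.Term a b} {f' : X.Term a' b'} : Rel f f' → Rel f' f
  | trans {a b a' b' a'' b''} {f : X.Term a b} {f' : X.Term a' b'} {f'' : X.Term a'' b''} :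
      Rel f f' → Rel f' f'' → Rel f f''
  | comp_congr {a b c a' b' c'} {f : X.Term a b} {g : X.Term b c}
      {f' : X.Term a' b'} {g' : X.Term b' c'} :
      Rel f f' → Rel g g' → Rel (comp f g) (comp f' g')
  | lcomp_congr {a b a' b'} (i x hx hx') {f : X.Term a b} {f' : X.Term a' b'} :
      Rel f f' → Rel (lcomp i x hx f) (lcomp i x hx' f')
  | rcomp_congr {a b a' b'} (i y hy hy') {f : X.Term a b} {f' : X.Term a' b'} :
      Rel f f' → Rel (rcomp i f y hy) (rcomp i f' y hy')
  | one_comp {a b} (ha) (f : X.Term a b) : Rel (comp (one a ha) f) f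
  | comp_one {a b} (hb) (f : X.Term a b) : Rel (comp f (one b hb)) f
  | assoc {a b c d} (f : X.Term a b) (g : X.Term b c) (h : X.Term c d) :
      Rel (comp (comp f g) h) (comp f (comp g h))
  | one_lcomp {a b} (i w) (hw : C.dim w < n) (hx) (f : X.Term a b) :
      Rel (lcomp i (C.one w) hx f) f
  | rcomp_one {a b} (i w) (hw : C.dim w < n) (hy) (f : X.Term a b) :
      Rel (rcomp i f (C.one w) hy) f
  | lcomp_one (i x a hx ha ha') : Rel (lcomp i x hx (one a ha)) (one (C.comp i x a) ha')
  | one_rcomp (i y a hy ha ha') : Rel (rcomp i (one a ha) y hy) (one (C.comp i a y) ha')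
  | lcomp_lcomp {a b} (i x y) (hxy : C.Composable i x y) (hx hy h) (f : X.Term a b) :
      Rel (lcomp i (C.comp i x y) h f) (lcomp i x hx (lcomp i y hy f))
  | rcomp_rcomp {a b} (i x y) (hxy : C.Composable i x y) (hx hy h) (f : X.Term a b) :
      Rel (rcomp i (rcomp i f x hx) y hy) (rcomp i f (C.comp i x y) h)
  | lcomp_rcomp {a b} (i x y hx hy hx' hy') (f : X.Term a b) :
      Rel (rcomp i (lcomp i x hx f) y hy) (lcomp i x hx' (rcomp i f y hy'))
  | lcomp_comp {a b c} (i x hx hx' hx'') (f : X.Term a b) (g : X.Term b c) :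
      Rel (lcomp i x hx (comp f g)) (comp (lcomp i x hx' f) (lcomp i x hx'' g))
  | comp_rcomp {a b c} (i y hy hy' hy'') (f : X.Term a b) (g : X.Term b c) :
      Rel (rcomp i (comp f g) y hy) (comp (rcomp i f y hy') (rcomp i g y hy''))
  | lcomp_distrib_lcomp {a b} (i j) (hij : i < j) (x y) (hxy : C.Composable i x y) (hx hy hx' h)
      (f : X.Term a b) :
      Rel (lcomp i x hx (lcomp j y hy f)) (lcomp j (C.comp i x y) h (lcomp i x hx' f))
  | lcomp_distrib_rcomp {a b} (i j) (hij : i < j) (x y) (hxy : C.Composable i x y) (hx hy hx' h)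
      (f : X.Term a b) :
      Rel (lcomp i x hx (rcomp j f y hy)) (rcomp j (lcomp i x hx' f) (C.comp i x y) h)
  | rcomp_distrib_lcomp {a b} (i j) (hij : i < j) (x y) (hxy : C.Composable i x y) (hx hy hy' h)
      (f : X.Term a b) :
      Rel (rcomp i (lcomp j x hx f) y hy) (lcomp j (C.comp i x y) h (rcomp i f y hy'))
  | rcomp_distrib_rcomp {a b} (i j) (hij : i < j) (x y) (hxy : C.Composable i x y) (hx hy hy' h)
      (f : X.Term a b) :
      Rel (rcomp i (rcomp j f x hx) y hy) (rcomp j (rcomp i f y hy') (C.comp i x y) h)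

/-- Two cells are parallel `n`-cells. -/
def Par (C : Precategory.{u} n) (a b : C.Cell) : Prop :=
  C.dim a = n ∧ C.dim b = n ∧ ∀ ε, 0 < n → C.bd ε a = C.bd ε b

theorem Par.bdTo {a b : C.Cell} (h : Par C a b) (ε : Bool) {i : ℕ} (hi : i < n) :
    C.bdTo ε i a = C.bdTo ε i b := by
  obtain ⟨h1, h2, h3⟩ := h
  rw [C.bdTo_of_lt (x := a) (by omega), C.bdTo_of_lt (x := b) (by omega), h3 ε (by omega)]

theorem Par.left {a b : C.Cell} (h : Par C a b) {i : ℕ} {x : C.Cell} (hx : C.Composable i x a) :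
    C.Composable i x b := by
  obtain ⟨h1, h2⟩ := hx
  refine ⟨by have := h.1; have := h.2.1; omega, ?_⟩
  have := h.1
  rw [h2, h.bdTo _ (by omega)]

theorem Par.right {a b : C.Cell} (h : Par C a b) {i : ℕ} {y : C.Cell} (hy : C.Composable i a y) :
    C.Composable i b y := by
  obtain ⟨h1, h2⟩ := hy
  refine ⟨by have := h.1; have := h.2.1; omega, ?_⟩
  have := h.1
  rw [← h2, h.bdTo _ (by omega)]

theorem dim_le' (x : C.Cell) : C.dim x ≤ n := by exact_mod_cast C.dim_le x

variable {X}

theorem Term.par {a b : C.Cell} (f : X.Term a b) : Par C a b := by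
  induction f with
  | gen g => exact ⟨X.dim_bd _ _, X.dim_bd _ _, fun ε h => X.globular ε g h⟩
  | one a ha => exact ⟨ha, ha, fun _ _ => rfl⟩
  | comp f g ihf ihg =>
    exact ⟨ihf.1, ihg.2.1, fun ε h => (ihf.2.2 ε h).trans (ihg.2.2 ε h)⟩
  | @lcomp a b i x hx f ih =>
    have hb := ih.left hx
    have hxn := dim_le' x
    obtain ⟨h1, h2, h3⟩ := ih
    refine ⟨by rw [C.dim_comp _ _ _ hx]; omega, by rw [C.dim_comp _ _ _ hb]; omega, ?_⟩
    intro ε hn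
    rcases lt_or_eq_of_le hxn with hlt | heq
    · rw [C.bd_comp_lt _ _ _ _ hx (by omega), C.bd_comp_lt _ _ _ _ hb (by omega), h3 ε hn]
    · cases ε
      · rw [C.src_comp _ _ _ hx (by omega), C.src_comp _ _ _ hb (by omega)]
      · rw [C.tgt_comp _ _ _ hx (by omega), C.tgt_comp _ _ _ hb (by omega), h3 _ hn]
  | @rcomp a b i f y hy ih =>
    have hb := ih.right hy
    have hyn := dim_le' y
    obtain ⟨h1, h2, h3⟩ := ih
    refine ⟨by rw [C.dim_comp _ _ _ hy]; omega, by rw [C.dim_comp _ _ _ hb]; omega, ?_⟩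
    intro ε hn
    rcases lt_or_eq_of_le hyn with hlt | heq
    · rw [C.bd_comp_gt _ _ _ _ hy (by omega), C.bd_comp_gt _ _ _ _ hb (by omega), h3 ε hn]
    · cases ε
      · rw [C.src_comp _ _ _ hy (by omega), C.src_comp _ _ _ hb (by omega), h3 _ hn]
      · rw [C.tgt_comp _ _ _ hy (by omega), C.tgt_comp _ _ _ hb (by omega)]

theorem left_lt {i : ℕ} {x a : C.Cell} (h : C.Composable i x a) (ha : C.dim a = n) :
    C.dim x = i + 1 ∧ i < n := by
  have := dim_le' x
  have := h.1
  omega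

theorem right_lt {i : ℕ} {x a : C.Cell} (h : C.Composable i a x) (ha : C.dim a = n) :
    C.dim x = i + 1 ∧ i < n := by
  have := dim_le' x
  have := h.1
  omega

theorem Rel.bd_eq {a b a' b' : C.Cell} {f : X.Term a b} {f' : X.Term a' b'} (h : X.Rel f f') :
    a = a' ∧ b = b' := by
  induction h with
  | refl f => exact ⟨rfl, rfl⟩
  | symm _ ih => exact ⟨ih.1.symm, ih.2.symm⟩
  | trans _ _ ih1 ih2 => exact ⟨ih1.1.trans ih2.1, ih1.2.trans ih2.2⟩
  | comp_congr _ _ ih1 ih2 => exact ⟨ih1.1, ih2.2⟩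
  | lcomp_congr _ _ _ _ _ ih => rw [ih.1, ih.2]; exact ⟨rfl, rfl⟩
  | rcomp_congr _ _ _ _ _ ih => rw [ih.1, ih.2]; exact ⟨rfl, rfl⟩
  | one_comp => exact ⟨rfl, rfl⟩
  | comp_one => exact ⟨rfl, rfl⟩
  | assoc => exact ⟨rfl, rfl⟩
  | one_lcomp i w hw hx f =>
    have hw' : (C.dim w : ℕ∞) < n := by exact_mod_cast hw
    have h1 := C.dim_one w hw'
    have h2 := f.par
    exact ⟨C.one_comp_le _ _ _ hw' hx (by rw [h2.1]; exact hw),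
      C.one_comp_le _ _ _ hw' (h2.left hx) (by rw [h2.2.1]; exact hw)⟩
  | rcomp_one i w hw hy f =>
    have hw' : (C.dim w : ℕ∞) < n := by exact_mod_cast hw
    have h1 := C.dim_one w hw'
    have h2 := f.par
    exact ⟨C.comp_one_le _ _ _ hw' hy (by rw [h2.1]; exact hw),
      C.comp_one_le _ _ _ hw' (h2.right hy) (by rw [h2.2.1]; exact hw)⟩
  | lcomp_one => exact ⟨rfl, rfl⟩
  | one_rcomp => exact ⟨rfl, rfl⟩
  | lcomp_lcomp i x y hxy hx hy h f =>
    have hf := f.par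
    have := (left_lt hy hf.1).1
    have := (left_lt h hf.1).1
    have := C.dim_comp _ _ _ hxy
    have := hxy.1
    have := hf.1
    have := hf.2.1
    have := hy.1
    exact ⟨C.assoc _ _ _ _ hxy hy (by omega), C.assoc _ _ _ _ hxy (hf.left hy) (by omega)⟩
  | rcomp_rcomp i x y hxy hx hy h f =>
    have hf := f.par
    have := (right_lt hx hf.1).1
    have := (right_lt h hf.1).1
    have := C.dim_comp _ _ _ hxy
    have := hxy.1
    have := hf.1
    have := hf.2.1
    have := hx.1
    exact ⟨C.assoc _ _ _ _ hx hxy (by omega), C.assoc _ _ _ _ (hf.right hx) hxy (by omega)⟩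
  | lcomp_rcomp i x y hx hy hx' hy' f =>
    have hf := f.par
    have := (left_lt hx hf.1).1
    have := (right_lt hy' hf.1).1
    exact ⟨C.assoc _ _ _ _ hx hy' (by omega),
      C.assoc _ _ _ _ (hf.left hx) (hf.right hy') (by omega)⟩
  | lcomp_comp => exact ⟨rfl, rfl⟩
  | comp_rcomp => exact ⟨rfl, rfl⟩
  | lcomp_distrib_lcomp i j hij x y hxy hx hy hx' h f =>
    exact ⟨C.comp_distrib _ _ _ _ _ hij hxy hy,
      C.comp_distrib _ _ _ _ _ hij hxy (f.par.left hy)⟩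
  | lcomp_distrib_rcomp i j hij x y hxy hx hy hx' h f =>
    exact ⟨C.comp_distrib _ _ _ _ _ hij hx' hy,
      C.comp_distrib _ _ _ _ _ hij (f.par.left hx') (f.par.right hy)⟩
  | rcomp_distrib_lcomp i j hij x y hxy hx hy hy' h f =>
    exact ⟨C.distrib_comp _ _ _ _ _ hij hxy hx,
      C.distrib_comp _ _ _ _ _ hij hxy (f.par.left hx)⟩
  | rcomp_distrib_rcomp i j hij x y hxy hx hy hy' h f =>
    exact ⟨C.distrib_comp _ _ _ _ _ hij hy' hx,
      C.distrib_comp _ _ _ _ _ hij (f.par.right hy') (f.par.right hx)⟩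

variable (X)

/-- Formal composites with arbitrary source and target, up to the congruence. -/
def termSetoid : Setoid (Σ a b : C.Cell, X.Term a b) where
  r p q := X.Rel p.2.2 q.2.2
  iseqv := ⟨fun p => Rel.refl p.2.2, Rel.symm, Rel.trans⟩

/-- The `(n+1)`-cells freely generated by `X` over `C`. -/
def New : Type u := Quotient X.termSetoid

variable {X}

def New.mk {a b : C.Cell} (f : X.Term a b) : X.New := Quotient.mk X.termSetoid ⟨a, b, f⟩

theorem New.sound {a b a' b' : C.Cell} {f : X.Term a b} {f' : X.Term a' b'} (h : X.Rel f f') :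
    New.mk f = New.mk f' := Quotient.sound (s := X.termSetoid) h

theorem New.exact {a b a' b' : C.Cell} {f : X.Term a b} {f' : X.Term a' b'}
    (h : New.mk f = New.mk f') : X.Rel f f' := Quotient.exact (s := X.termSetoid) h

theorem New.ind {p : X.New → Prop} (h : ∀ (a b : C.Cell) (f : X.Term a b), p (New.mk f))
    (q : X.New) : p q := Quotient.inductionOn q fun ⟨a, b, f⟩ => h a b f

def New.bd (ε : Bool) (q : X.New) : C.Cell :=
  Quotient.lift (s := X.termSetoid) (fun p => cond ε p.2.1 p.1)
    (fun p q h => by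
      have := Rel.bd_eq h
      cases ε
      · exact this.1
      · exact this.2) q

theorem New.exists_rep (q : X.New) : ∃ f : X.Term (q.bd false) (q.bd true), New.mk f = q := by
  induction q using New.ind with
  | h a b f => exact ⟨f, rfl⟩

/-- A formal composite representing a cell. -/
noncomputable def New.rep (q : X.New) : X.Term (q.bd false) (q.bd true) := q.exists_rep.choose

theorem New.mk_rep (q : X.New) : New.mk q.rep = q := q.exists_rep.choose_spec

theorem New.par (q : X.New) : Par C (q.bd false) (q.bd true) := q.rep.par

open Classical in
noncomputable def New.comp (q r : X.New) : X.New :=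
  if h : q.bd true = r.bd false then
    New.mk (Term.comp q.rep (cast (congrArg (fun a => X.Term a (r.bd true)) h.symm) r.rep))
  else q

open Classical in
noncomputable def New.lcomp (i : ℕ) (x : C.Cell) (q : X.New) : X.New :=
  if h : C.Composable i x (q.bd false) then New.mk (Term.lcomp i x h q.rep) else q

open Classical in
noncomputable def New.rcomp (i : ℕ) (q : X.New) (y : C.Cell) : X.New :=
  if h : C.Composable i (q.bd false) y then New.mk (Term.rcomp i q.rep y h) else q

@[simp] theorem New.bd_false_mk {a b : C.Cell} (f : X.Term a b) : (New.mk f).bd false = a := rfl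

@[simp] theorem New.bd_true_mk {a b : C.Cell} (f : X.Term a b) : (New.mk f).bd true = b := rfl

theorem New.comp_mk {a b c : C.Cell} (f : X.Term a b) (g : X.Term b c) :
    New.comp (New.mk f) (New.mk g) = New.mk (Term.comp f g) := by
  unfold New.comp
  rw [dif_pos (by rfl)]
  exact New.sound (Rel.comp_congr (New.exact (New.mk_rep (New.mk f)))
    (New.exact (New.mk_rep (New.mk g))))

theorem New.lcomp_mk {a b : C.Cell} (i : ℕ) (x : C.Cell) (h : C.Composable i x a)
    (f : X.Term a b) : New.lcomp i x (New.mk f) = New.mk (Term.lcomp i x h f) := by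
  unfold New.lcomp
  rw [dif_pos (by exact h)]
  exact New.sound (Rel.lcomp_congr _ _ _ _ (New.exact (New.mk_rep (New.mk f))))

theorem New.rcomp_mk {a b : C.Cell} (i : ℕ) (y : C.Cell) (h : C.Composable i a y)
    (f : X.Term a b) : New.rcomp i (New.mk f) y = New.mk (Term.rcomp i f y h) := by
  unfold New.rcomp
  rw [dif_pos (by exact h)]
  exact New.sound (Rel.rcomp_congr _ _ _ _ (New.exact (New.mk_rep (New.mk f))))

end CellExtension

namespace CellExtension

variable {n : ℕ} {C : Precategory.{u} n} (X : CellExtension C)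

def extDim : C.Cell ⊕ X.New → ℕ
  | Sum.inl x => C.dim x
  | Sum.inr _ => n + 1

def extBd (ε : Bool) : C.Cell ⊕ X.New → C.Cell ⊕ X.New
  | Sum.inl x => Sum.inl (C.bd ε x)
  | Sum.inr q => Sum.inl (q.bd ε)

/-- The globular set with the cells of `C` and the new `(n+1)`-cells. -/
abbrev extGlobularSet : GlobularSet.{u} where
  Cell := C.Cell ⊕ X.New
  dim := X.extDim
  bd := X.extBd
  dim_bd := by
    rintro ε (x | q)
    · exact C.dim_bd ε x
    · have := q.par
      cases ε
      · exact this.1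
      · exact this.2.1
  bd_zero := by
    rintro ε (x | q) h
    · exact congrArg Sum.inl (C.bd_zero ε x h)
    · exact absurd h (Nat.succ_ne_zero n)
  globular := by
    rintro ε (x | q) h
    · exact congrArg Sum.inl (C.globular ε x h)
    · have h' : 2 ≤ n + 1 := h
      exact congrArg Sum.inl (q.par.2.2 ε (by omega))

@[simp] theorem ext_dim_inl (x : C.Cell) : X.extDim (Sum.inl x) = C.dim x := rfl
@[simp] theorem ext_dim_inr (q : X.New) : X.extDim (Sum.inr q) = n + 1 := rfl
@[simp] theorem ext_bd_inl (ε : Bool) (x : C.Cell) :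
    X.extBd ε (Sum.inl x) = Sum.inl (C.bd ε x) := rfl
@[simp] theorem ext_bd_inr (ε : Bool) (q : X.New) :
    X.extBd ε (Sum.inr q) = Sum.inl (q.bd ε) := rfl

@[simp] theorem ext_bdTo_inl (ε : Bool) (i : ℕ) (x : C.Cell) :
    X.extGlobularSet.bdTo ε i (Sum.inl x) = Sum.inl (C.bdTo ε i x) := by
  have key : ∀ (d : ℕ) (x : C.Cell),
      (X.extBd ε)^[d] (Sum.inl x) = Sum.inl ((C.bd ε)^[d] x) := by
    intro d
    induction d with
    | zero => exact fun _ => rfl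
    | succ d ih => exact fun x => ih (C.bd ε x)
  exact key (C.dim x - i) x

theorem ext_bdTo_inr (ε : Bool) {i : ℕ} (hi : i < n + 1) (q : X.New) :
    X.extGlobularSet.bdTo ε i (Sum.inr q) = Sum.inl (C.bdTo ε i (q.bd ε)) := by
  rw [X.extGlobularSet.bdTo_of_lt (by simpa using hi)]
  exact X.ext_bdTo_inl ε i (q.bd ε)

theorem composable_inl_inl {i : ℕ} {x y : C.Cell} :
    X.extGlobularSet.Composable i (Sum.inl x) (Sum.inl y) ↔ C.Composable i x y := by
  unfold GlobularSet.Composable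
  simp

theorem composable_inl_inr {i : ℕ} {x : C.Cell} {q : X.New} :
    X.extGlobularSet.Composable i (Sum.inl x) (Sum.inr q) ↔ C.Composable i x (q.bd false) := by
  unfold GlobularSet.Composable
  have h1 := dim_le' x
  have h2 := q.par.1
  simp only [ext_dim_inl, ext_dim_inr, ext_bdTo_inl]
  constructor
  · rintro ⟨h, h'⟩
    rw [ext_bdTo_inr _ _ (by omega)] at h'
    exact ⟨by omega, Sum.inl_injective h'⟩
  · rintro ⟨h, h'⟩
    rw [ext_bdTo_inr _ _ (by omega)]
    exact ⟨by omega, congrArg Sum.inl h'⟩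

theorem composable_inr_inl {i : ℕ} {q : X.New} {y : C.Cell} :
    X.extGlobularSet.Composable i (Sum.inr q) (Sum.inl y) ↔ C.Composable i (q.bd false) y := by
  unfold GlobularSet.Composable
  have h1 := dim_le' y
  have h2 := q.par.1
  simp only [ext_dim_inl, ext_dim_inr, ext_bdTo_inl]
  constructor
  · rintro ⟨h, h'⟩
    rw [ext_bdTo_inr _ _ (by omega), ← q.par.bdTo _ (by omega)] at h'
    exact ⟨by omega, Sum.inl_injective h'⟩
  · rintro ⟨h, h'⟩
    rw [ext_bdTo_inr _ _ (by omega), ← q.par.bdTo _ (by omega)]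
    exact ⟨by omega, congrArg Sum.inl h'⟩

theorem composable_inr_inr {i : ℕ} {q r : X.New} :
    X.extGlobularSet.Composable i (Sum.inr q) (Sum.inr r) ↔ i = n ∧ q.bd true = r.bd false := by
  unfold GlobularSet.Composable
  have h1 := q.par.2.1
  have h2 := r.par.1
  simp only [ext_dim_inr]
  constructor
  · rintro ⟨h, h'⟩
    have hi : i = n := by omega
    rw [ext_bdTo_inr _ _ (by omega), ext_bdTo_inr _ _ (by omega), C.bdTo_self (by omega),
      C.bdTo_self (by omega)] at h'
    exact ⟨hi, Sum.inl_injective h'⟩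
  · rintro ⟨h, h'⟩
    rw [ext_bdTo_inr _ _ (by omega), ext_bdTo_inr _ _ (by omega), C.bdTo_self (by omega),
      C.bdTo_self (by omega)]
    exact ⟨by omega, congrArg Sum.inl h'⟩

open Classical in
noncomputable def extOne : C.Cell ⊕ X.New → C.Cell ⊕ X.New
  | Sum.inl x => if h : C.dim x = n then Sum.inr (New.mk (Term.one x h)) else Sum.inl (C.one x)
  | Sum.inr q => Sum.inr q

noncomputable def extComp (i : ℕ) : C.Cell ⊕ X.New → C.Cell ⊕ X.New → C.Cell ⊕ X.New
  | Sum.inl x, Sum.inl y => Sum.inl (C.comp i x y)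
  | Sum.inl x, Sum.inr q => Sum.inr (New.lcomp i x q)
  | Sum.inr q, Sum.inl y => Sum.inr (New.rcomp i q y)
  | Sum.inr q, Sum.inr r => Sum.inr (New.comp q r)

variable {X}

theorem New.ind_comp {q r : X.New} (h : q.bd true = r.bd false) :
    ∃ (a b c : C.Cell) (f : X.Term a b) (g : X.Term b c), q = New.mk f ∧ r = New.mk g := by
  induction q using New.ind with
  | h a b f =>
    induction r using New.ind with
    | h b' c g =>
      obtain rfl : b = b' := h
      exact ⟨a, b, c, f, g, rfl, rfl⟩

variable (X)

/-- The `(n+1)`-precategory freely generated by the `n`-precategory `C` and the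
`(n+1)`-generators `X`. -/
noncomputable def freeExt : Precategory.{u} ((n + 1 : ℕ) : ℕ∞) where
  toGlobularSet := X.extGlobularSet
  dim_le := by
    rintro (x | q)
    · have := dim_le' x
      simp only [ext_dim_inl]
      exact_mod_cast (by omega : C.dim x ≤ n + 1)
    · exact le_refl _
  one := X.extOne
  comp := X.extComp
  dim_one := by
    rintro (x | q) h
    · unfold extOne
      have h0 := dim_le' x
      by_cases hx : C.dim x = n
      · simp [hx]
      · simp only [hx, dif_neg, not_false_eq_true, ext_dim_inl]
        exact C.dim_one x (by exact_mod_cast (by omega : C.dim x < n))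
    · simp at h
  dim_comp := by
    rintro i (x | q) (y | r) h
    · exact C.dim_comp i x y (X.composable_inl_inl.1 h)
    · have := dim_le' x
      simp only [extComp, ext_dim_inl, ext_dim_inr]; omega
    · have := dim_le' y
      simp only [extComp, ext_dim_inl, ext_dim_inr]; omega
    · simp [extComp]
  bd_one := by
    rintro ε (x | q) h
    · unfold extOne
      have h0 := dim_le' x
      by_cases hx : C.dim x = n
      · simp only [hx, dif_pos, ext_bd_inr]
        cases ε <;> rfl
      · simp only [hx, dif_neg, not_false_eq_true, ext_bd_inl]
        rw [C.bd_one ε x (by exact_mod_cast (by omega : C.dim x < n))]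
    · simp at h
  bd_comp_lt := by
    rintro ε i (x | q) (y | r) h hd
    · exact congrArg Sum.inl (C.bd_comp_lt ε i x y (X.composable_inl_inl.1 h) hd)
    · rw [composable_inl_inr] at h
      induction r using New.ind with
      | h a b f =>
        replace h : C.Composable i x a := h
        simp only [extComp, New.lcomp_mk i x h, ext_bd_inr]
        cases ε <;> rfl
    · have := dim_le' y
      simp only [ext_dim_inl, ext_dim_inr] at hd
      omega
    · simp at hd
  src_comp := by
    rintro i (x | q) (y | r) h hd
    · exact congrArg Sum.inl (C.src_comp i x y (X.composable_inl_inl.1 h) hd)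
    · have := dim_le' x
      simp only [ext_dim_inl, ext_dim_inr] at hd
      omega
    · have := dim_le' y
      simp only [ext_dim_inl, ext_dim_inr] at hd
      omega
    · rw [composable_inr_inr] at h
      obtain ⟨a, b, c, f, g, rfl, rfl⟩ := New.ind_comp h.2
      simp [extComp, New.comp_mk]
  tgt_comp := by
    rintro i (x | q) (y | r) h hd
    · exact congrArg Sum.inl (C.tgt_comp i x y (X.composable_inl_inl.1 h) hd)
    · have := dim_le' x
      simp only [ext_dim_inl, ext_dim_inr] at hd
      omega
    · have := dim_le' y
      simp only [ext_dim_inl, ext_dim_inr] at hd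
      omega
    · rw [composable_inr_inr] at h
      obtain ⟨a, b, c, f, g, rfl, rfl⟩ := New.ind_comp h.2
      simp [extComp, New.comp_mk]
  bd_comp_gt := by
    rintro ε i (x | q) (y | r) h hd
    · exact congrArg Sum.inl (C.bd_comp_gt ε i x y (X.composable_inl_inl.1 h) hd)
    · have := dim_le' x
      simp only [ext_dim_inl, ext_dim_inr] at hd
      omega
    · rw [composable_inr_inl] at h
      induction q using New.ind with
      | h a b f =>
        replace h : C.Composable i a y := h
        simp only [extComp, New.rcomp_mk i y h, ext_bd_inr]
        cases ε <;> rfl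
    · simp at hd
  one_comp_le := by
    rintro i (x | q) y hx h hd
    · have h0 := dim_le' x
      by_cases hxn : C.dim x = n
      · have e : X.extOne (Sum.inl x) = Sum.inr (New.mk (Term.one x hxn)) := by
          simp [extOne, hxn]
        rw [e] at h ⊢
        rcases y with y | r
        · have := dim_le' y
          simp only [ext_dim_inl] at hd
          omega
        · rw [composable_inr_inr] at h
          induction r using New.ind with
          | h a b f =>
            obtain rfl : x = a := h.2
            simp only [extComp, New.comp_mk]
            exact congrArg Sum.inr (New.sound (Rel.one_comp _ _))
      · have hx' : C.dim x < n := by omega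
        have hx'' : (C.dim x : ℕ∞) < n := by exact_mod_cast hx'
        have e : X.extOne (Sum.inl x) = Sum.inl (C.one x) := by
          simp [extOne, hxn]
        rw [e] at h ⊢
        rcases y with y | r
        · rw [composable_inl_inl] at h
          exact congrArg Sum.inl (C.one_comp_le i x y hx'' h hd)
        · rw [composable_inl_inr] at h
          induction r using New.ind with
          | h a b f =>
            replace h : C.Composable i (C.one x) a := h
            simp only [extComp, New.lcomp_mk i _ h]
            exact congrArg Sum.inr (New.sound (Rel.one_lcomp _ _ hx' _ _))
    · simp at hx
  one_comp_gt := by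
    rintro i (x | q) (y | r) hx h hd
    · have h0 := dim_le' x
      rw [composable_inl_inl] at h
      simp only [ext_dim_inl] at hd
      have hc := C.dim_comp _ _ _ h
      by_cases hxn : C.dim x = n
      · have hc' : C.dim (C.comp i x y) = n := by omega
        simp only [extOne, extComp, hxn, hc', dif_pos, New.rcomp_mk i y h]
        exact congrArg Sum.inr (New.sound (Rel.one_rcomp _ _ _ _ _ _))
      · have hx' : C.dim x < n := by omega
        have hx'' : (C.dim x : ℕ∞) < n := by exact_mod_cast hx'
        have hc' : C.dim (C.comp i x y) ≠ n := by omega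
        simp only [extOne, extComp, hxn, hc', dif_neg, not_false_eq_true]
        exact congrArg Sum.inl (C.one_comp_gt i x y hx'' h hd)
    · have h0 := dim_le' x
      simp only [ext_dim_inl, ext_dim_inr] at hd
      rw [composable_inl_inr] at h
      omega
    · simp at hx
    · simp at hx
  comp_one_le := by
    rintro i x (y | q) hy h hd
    · have h0 := dim_le' y
      by_cases hyn : C.dim y = n
      · have e : X.extOne (Sum.inl y) = Sum.inr (New.mk (Term.one y hyn)) := by
          simp [extOne, hyn]
        rw [e] at h ⊢
        rcases x with x | r
        · have := dim_le' x
          simp only [ext_dim_inl] at hd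
          omega
        · rw [composable_inr_inr] at h
          induction r using New.ind with
          | h a b f =>
            obtain rfl : b = y := h.2
            simp only [extComp, New.comp_mk]
            exact congrArg Sum.inr (New.sound (Rel.comp_one _ _))
      · have hy' : C.dim y < n := by omega
        have hy'' : (C.dim y : ℕ∞) < n := by exact_mod_cast hy'
        have e : X.extOne (Sum.inl y) = Sum.inl (C.one y) := by
          simp [extOne, hyn]
        rw [e] at h ⊢
        rcases x with x | r
        · rw [composable_inl_inl] at h
          exact congrArg Sum.inl (C.comp_one_le i x y hy'' h hd)
        · rw [composable_inr_inl] at h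
          induction r using New.ind with
          | h a b f =>
            replace h : C.Composable i a (C.one y) := h
            simp only [extComp, New.rcomp_mk i _ h]
            exact congrArg Sum.inr (New.sound (Rel.rcomp_one _ _ hy' _ _))
    · simp at hy
  comp_one_gt := by
    rintro i (x | r) (y | q) hy h hd
    · have h0 := dim_le' y
      rw [composable_inl_inl] at h
      simp only [ext_dim_inl] at hd
      have hc := C.dim_comp _ _ _ h
      by_cases hyn : C.dim y = n
      · have hc' : C.dim (C.comp i x y) = n := by omega
        simp only [extOne, extComp, hyn, hc', dif_pos, New.lcomp_mk i x h]
        exact congrArg Sum.inr (New.sound (Rel.lcomp_one _ _ _ _ _ _))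
      · have hy' : C.dim y < n := by omega
        have hy'' : (C.dim y : ℕ∞) < n := by exact_mod_cast hy'
        have hc' : C.dim (C.comp i x y) ≠ n := by omega
        simp only [extOne, extComp, hyn, hc', dif_neg, not_false_eq_true]
        exact congrArg Sum.inl (C.comp_one_gt i x y hy'' h hd)
    · simp at hy
    · have h0 := dim_le' y
      simp only [ext_dim_inl, ext_dim_inr] at hd
      rw [composable_inr_inl] at h
      omega
    · simp at hy
  assoc := by
    rintro i (x | p) (y | q) (z | r) h1 h2 hd
    · exact congrArg Sum.inl
        (C.assoc i x y z (X.composable_inl_inl.1 h1) (X.composable_inl_inl.1 h2) hd)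
    · rw [composable_inl_inl] at h1
      rw [composable_inl_inr] at h2
      induction r using New.ind with
      | h a b f =>
        have hf := f.par
        have h2' : C.Composable i y a := h2
        have := left_lt h2' hf.1
        have := hf.1
        simp only [ext_dim_inl, ext_dim_inr] at hd
        have h0 := C.dim_comp _ _ _ h1
        have h3 : C.Composable i (C.comp i x y) a :=
          ⟨by omega, by rw [C.bdTo_true_comp h1]; exact h2'.2⟩
        have h4 : C.Composable i x (C.comp i y a) := by
          refine ⟨by rw [C.dim_comp _ _ _ h2']; omega, by rw [C.bdTo_false_comp h2']; exact h1.2⟩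
        simp only [extComp, New.lcomp_mk i y h2', New.lcomp_mk i _ h3, New.lcomp_mk i x h4]
        exact congrArg Sum.inr (New.sound (Rel.lcomp_lcomp _ _ _ h1 _ _ _ _))
    · rw [composable_inl_inr] at h1
      rw [composable_inr_inl] at h2
      induction q using New.ind with
      | h a b f =>
        have hf := f.par
        have h1' : C.Composable i x a := h1
        have h2' : C.Composable i a z := h2
        have := left_lt h1' hf.1
        have := right_lt h2' hf.1
        have := hf.1
        have h3 : C.Composable i (C.comp i x a) z :=
          ⟨by rw [C.dim_comp _ _ _ h1']; omega, by rw [C.bdTo_true_comp h1']; exact h2'.2⟩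
        have h4 : C.Composable i x (C.comp i a z) := by
          refine ⟨by rw [C.dim_comp _ _ _ h2']; omega, by rw [C.bdTo_false_comp h2']; exact h1'.2⟩
        simp only [extComp, New.lcomp_mk i x h1', New.rcomp_mk i z h2', New.rcomp_mk i z h3,
          New.lcomp_mk i x h4]
        exact congrArg Sum.inr (New.sound (Rel.lcomp_rcomp _ _ _ _ _ _ _ _))
    · rw [composable_inl_inr] at h1
      rw [composable_inr_inr] at h2
      have := left_lt h1 q.par.1
      omega
    · rw [composable_inr_inl] at h1
      rw [composable_inl_inl] at h2
      induction p using New.ind with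
      | h a b f =>
        have hf := f.par
        have h1' : C.Composable i a y := h1
        have := right_lt h1' hf.1
        have := hf.1
        simp only [ext_dim_inl, ext_dim_inr] at hd
        have h0 := C.dim_comp _ _ _ h2
        have h3 : C.Composable i a (C.comp i y z) :=
          ⟨by omega, by rw [C.bdTo_false_comp h2]; exact h1'.2⟩
        have h4 : C.Composable i (C.comp i a y) z := by
          have := h2.1
          refine ⟨by rw [C.dim_comp _ _ _ h1']; omega, by rw [C.bdTo_true_comp h1']; exact h2.2⟩
        simp only [extComp, New.rcomp_mk i y h1', New.rcomp_mk i _ h3, New.rcomp_mk i z h4]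
        exact congrArg Sum.inr (New.sound (Rel.rcomp_rcomp _ _ _ h2 _ _ _ _))
    · have h := dim_le' y
      have := h1.1
      simp only [ext_dim_inl, ext_dim_inr] at hd this
      omega
    · rw [composable_inr_inl] at h2
      rw [composable_inr_inr] at h1
      have := right_lt h2 q.par.1
      omega
    · rw [composable_inr_inr] at h1 h2
      obtain ⟨rfl, h1⟩ := h1
      replace h2 := h2.2
      induction p using New.ind with
      | h a b f =>
        induction q using New.ind with
        | h b' c g =>
          induction r using New.ind with
          | h c' d k =>
            obtain rfl : b = b' := h1
            obtain rfl : c = c' := h2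
            simp only [extComp, New.comp_mk]
            exact congrArg Sum.inr (New.sound (Rel.assoc _ _ _))
  comp_distrib := by
    rintro i j (x | p) (y | q) (z | r) hij h1 h2
    · exact congrArg Sum.inl
        (C.comp_distrib i j x y z hij (X.composable_inl_inl.1 h1) (X.composable_inl_inl.1 h2))
    · rw [composable_inl_inl] at h1
      rw [composable_inl_inr] at h2
      induction r using New.ind with
      | h a b f =>
        have hf := f.par
        have h2' : C.Composable j y a := h2
        have e2 := left_lt h2' hf.1
        have e1 := h1.1
        have e3 := hf.1
        have hl := C.bdTo_low (ε := false) hij h2'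
        have h3 : C.Composable i x a := ⟨by omega, by rw [← hl.1]; exact h1.2⟩
        have h4 : C.Composable i x (C.comp j y a) :=
          ⟨by rw [C.dim_comp _ _ _ h2']; omega, by rw [hl.2]; exact h1.2⟩
        have h5 : C.Composable j (C.comp i x y) (C.comp i x a) := by
          refine ⟨by rw [C.dim_comp _ _ _ h1, C.dim_comp _ _ _ h3]; omega, ?_⟩
          rw [C.bdTo_comp_high_left hij (C.dim y - j) (by omega) (by omega) h1,
            C.bdTo_comp_high_left hij (C.dim a - j) (by omega) (by omega) h3, h2'.2]
        simp only [extComp, New.lcomp_mk j y h2', New.lcomp_mk i x h4, New.lcomp_mk i x h3,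
          New.lcomp_mk j _ h5]
        exact congrArg Sum.inr (New.sound (Rel.lcomp_distrib_lcomp _ _ hij _ _ h1 _ _ _ _ _))
    · rw [composable_inl_inr] at h1
      rw [composable_inr_inl] at h2
      induction q using New.ind with
      | h a b f =>
        have hf := f.par
        have h1' : C.Composable i x a := h1
        have h2' : C.Composable j a z := h2
        have e2 := right_lt h2' hf.1
        have e1 := h1'.1
        have e3 := hf.1
        have hl := C.bdTo_low (ε := false) hij h2'
        have h3 : C.Composable i x z := ⟨by omega, by rw [← hl.1]; exact h1'.2⟩
        have h4 : C.Composable i x (C.comp j a z) :=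
          ⟨by rw [C.dim_comp _ _ _ h2']; omega, by rw [hl.2]; exact h1'.2⟩
        have h5 : C.Composable j (C.comp i x a) (C.comp i x z) := by
          refine ⟨by rw [C.dim_comp _ _ _ h1', C.dim_comp _ _ _ h3]; omega, ?_⟩
          rw [C.bdTo_comp_high_left hij (C.dim a - j) (by omega) (by omega) h1',
            C.bdTo_comp_high_left hij (C.dim z - j) (by omega) (by omega) h3, h2'.2]
        simp only [extComp, New.rcomp_mk j z h2', New.lcomp_mk i x h4, New.lcomp_mk i x h1',
          New.rcomp_mk j _ h5]
        exact congrArg Sum.inr (New.sound (Rel.lcomp_distrib_rcomp _ _ hij _ _ h3 _ _ _ _ _))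
    · rw [composable_inl_inr] at h1
      rw [composable_inr_inr] at h2
      obtain ⟨a, b, c, f, g, rfl, rfl⟩ := New.ind_comp h2.2
      have h1' : C.Composable i x a := h1
      have h3 := f.par.left h1'
      simp only [extComp, New.comp_mk, New.lcomp_mk i x h1', New.lcomp_mk i x h3]
      exact congrArg Sum.inr (New.sound (Rel.lcomp_comp _ _ _ _ _ _ _))
    all_goals
      exfalso
      have e1 := h1.1
      have e2 := h2.1
      try have e3 := dim_le' y
      try have e4 := dim_le' z
      simp only [ext_dim_inl, ext_dim_inr] at e1 e2
      omega
  distrib_comp := by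
    rintro i j (x | p) (y | q) (z | r) hij h1 h2
    · exact congrArg Sum.inl
        (C.distrib_comp i j x y z hij (X.composable_inl_inl.1 h1) (X.composable_inl_inl.1 h2))
    · exfalso
      have e1 := h1.1
      have e2 := h2.1
      have e3 := dim_le' x
      simp only [ext_dim_inl, ext_dim_inr] at e1 e2
      omega
    · rw [composable_inl_inl] at h1
      rw [composable_inl_inr] at h2
      induction q using New.ind with
      | h a b f =>
        have hf := f.par
        have h2' : C.Composable j x a := h2
        have e2 := left_lt h2' hf.1
        have e1 := h1.1
        have e3 := hf.1
        have hl := C.bdTo_low (ε := true) hij h2'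
        have h3 : C.Composable i a z := ⟨by omega, by rw [← hl.1]; exact h1.2⟩
        have h4 : C.Composable i (C.comp j x a) z :=
          ⟨by rw [C.dim_comp _ _ _ h2']; omega, by rw [hl.2]; exact h1.2⟩
        have h5 : C.Composable j (C.comp i x z) (C.comp i a z) := by
          refine ⟨by rw [C.dim_comp _ _ _ h1, C.dim_comp _ _ _ h3]; omega, ?_⟩
          rw [C.bdTo_comp_high_right hij (C.dim x - j) (by omega) (by omega) h1,
            C.bdTo_comp_high_right hij (C.dim a - j) (by omega) (by omega) h3, h2'.2]
        simp only [extComp, New.lcomp_mk j x h2', New.rcomp_mk i z h4, New.rcomp_mk i z h3,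
          New.lcomp_mk j _ h5]
        exact congrArg Sum.inr (New.sound (Rel.rcomp_distrib_lcomp _ _ hij _ _ h1 _ _ _ _ _))
    · exfalso
      have e1 := h1.1
      have e2 := h2.1
      have e3 := dim_le' x
      simp only [ext_dim_inl, ext_dim_inr] at e1 e2
      omega
    · rw [composable_inr_inl] at h1
      rw [composable_inr_inl] at h2
      induction p using New.ind with
      | h a b f =>
        have hf := f.par
        have h1' : C.Composable i a z := h1
        have h2' : C.Composable j a y := h2
        have e2 := right_lt h2' hf.1
        have e1 := h1'.1
        have e3 := hf.1
        have hl := C.bdTo_low (ε := true) hij h2'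
        have h3 : C.Composable i y z := ⟨by omega, by rw [← hl.1]; exact h1'.2⟩
        have h4 : C.Composable i (C.comp j a y) z :=
          ⟨by rw [C.dim_comp _ _ _ h2']; omega, by rw [hl.2]; exact h1'.2⟩
        have h5 : C.Composable j (C.comp i a z) (C.comp i y z) := by
          refine ⟨by rw [C.dim_comp _ _ _ h1', C.dim_comp _ _ _ h3]; omega, ?_⟩
          rw [C.bdTo_comp_high_right hij (C.dim a - j) (by omega) (by omega) h1',
            C.bdTo_comp_high_right hij (C.dim y - j) (by omega) (by omega) h3, h2'.2]
        simp only [extComp, New.rcomp_mk j y h2', New.rcomp_mk i z h4, New.rcomp_mk i z h1',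
          New.rcomp_mk j _ h5]
        exact congrArg Sum.inr (New.sound (Rel.rcomp_distrib_rcomp _ _ hij _ _ h3 _ _ _ _ _))
    · exfalso
      have e1 := h1.1
      have e2 := h2.1
      have e3 := dim_le' y
      simp only [ext_dim_inl, ext_dim_inr] at e1 e2
      omega
    · rw [composable_inr_inl] at h1
      rw [composable_inr_inr] at h2
      obtain ⟨a, b, c, f, g, rfl, rfl⟩ := New.ind_comp h2.2
      have h1' : C.Composable i a z := h1
      have h3 := f.par.right h1'
      simp only [extComp, New.comp_mk, New.rcomp_mk i z h1', New.rcomp_mk i z h3]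
      exact congrArg Sum.inr (New.sound (Rel.comp_rcomp _ _ _ _ _ _ _))
    · exfalso
      have e1 := h1.1
      have e2 := h2.1
      simp only [ext_dim_inr] at e1 e2
      omega

end CellExtension

/-- A morphism from an `n`-precategory to (the `n`-truncation of) an `m`-precategory, `n ≤ m`. -/
structure PrecatHom {n m : ℕ∞} (C : Precategory.{u} n) (D : Precategory.{u} m) where
  map : C.Cell → D.Cell
  dim_map : ∀ x, D.dim (map x) = C.dim x
  bd_map : ∀ ε x, D.bd ε (map x) = map (C.bd ε x)
  one_map : ∀ x, (C.dim x : ℕ∞) < n → map (C.one x) = D.one (map x)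
  comp_map : ∀ i x y, C.Composable i x y → map (C.comp i x y) = D.comp i (map x) (map y)

namespace PrecatHom

theorem bdTo_map {n m : ℕ∞} {C : Precategory.{u} n} {D : Precategory.{u} m}
    (F : PrecatHom C D) (ε : Bool) (i : ℕ) (x : C.Cell) :
    D.bdTo ε i (F.map x) = F.map (C.bdTo ε i x) := by
  have key : ∀ (d : ℕ) (x : C.Cell), (D.bd ε)^[d] (F.map x) = F.map ((C.bd ε)^[d] x) := by
    intro d
    induction d with
    | zero => exact fun _ => rfl
    | succ d ih =>
      intro x
      rw [Function.iterate_succ_apply, Function.iterate_succ_apply, F.bd_map, ih]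
  unfold GlobularSet.bdTo
  rw [F.dim_map]
  exact key _ x

theorem composable_map {n m : ℕ∞} {C : Precategory.{u} n} {D : Precategory.{u} m}
    (F : PrecatHom C D) {i : ℕ} {x y : C.Cell} (h : C.Composable i x y) :
    D.Composable i (F.map x) (F.map y) :=
  ⟨by rw [F.dim_map, F.dim_map]; exact h.1, by rw [F.bdTo_map, F.bdTo_map, h.2]⟩

def id {n : ℕ∞} (C : Precategory.{u} n) : PrecatHom C C where
  map x := x
  dim_map _ := rfl
  bd_map _ _ := rfl
  one_map _ _ := rfl
  comp_map _ _ _ _ := rfl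

def trans {n m k : ℕ∞} (hnm : n ≤ m) {C : Precategory.{u} n} {D : Precategory.{u} m}
    {E : Precategory.{u} k} (F : PrecatHom C D) (G : PrecatHom D E) : PrecatHom C E where
  map x := G.map (F.map x)
  dim_map x := by rw [G.dim_map, F.dim_map]
  bd_map ε x := by rw [G.bd_map, F.bd_map]
  one_map x h := by
    rw [F.one_map x h, G.one_map _ (by rw [F.dim_map]; exact lt_of_lt_of_le h hnm)]
  comp_map i x y h := by rw [F.comp_map _ _ _ h, G.comp_map _ _ _ (F.composable_map h)]

end PrecatHom

/-- The inclusion of `C` into a free extension. -/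
noncomputable def CellExtension.incl {n : ℕ} {C : Precategory.{u} n} (X : CellExtension C) :
    PrecatHom C X.freeExt where
  map := Sum.inl
  dim_map _ := rfl
  bd_map _ _ := rfl
  one_map x h := by
    have h' : C.dim x ≠ n := by
      intro e
      rw [e] at h
      exact lt_irrefl _ h
    change Sum.inl (C.one x) = X.extOne (Sum.inl x)
    simp [extOne, h']
  comp_map _ _ _ _ := rfl

/-- A sequence of `n`-precategories, for `n ∈ ℕ`, each mapping into the next one. -/
structure PrecatSeq where
  obj : ∀ n : ℕ, Precategory.{u} (n : ℕ∞)
  step : ∀ n : ℕ, PrecatHom (obj n) (obj (n + 1))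

namespace PrecatSeq

variable (S : PrecatSeq.{u})

def up {n : ℕ} (m : ℕ) (hnm : n ≤ m) : PrecatHom (S.obj n) (S.obj m) :=
  Nat.leRec (motive := fun m _ => PrecatHom (S.obj n) (S.obj m)) (PrecatHom.id _)
    (fun {m} h F => F.trans (by exact_mod_cast h) (S.step m)) hnm

theorem up_self (n : ℕ) (x : (S.obj n).Cell) : (S.up n le_rfl).map x = x := by
  unfold up
  rw [Nat.leRec_self]
  rfl

theorem up_succ {n m : ℕ} (h : n ≤ m) (x : (S.obj n).Cell) :
    (S.up (m + 1) (h.trans (Nat.le_succ m))).map x = (S.step m).map ((S.up m h).map x) := by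
  unfold up
  rw [Nat.leRec_succ _ _ h]
  rfl

theorem up_up {n m k : ℕ} (h : n ≤ m) (h' : m ≤ k) (x : (S.obj n).Cell) :
    (S.up k h').map ((S.up m h).map x) = (S.up k (h.trans h')).map x := by
  induction k, h' using Nat.le_induction with
  | base => rw [up_self]
  | succ k hk ih => rw [S.up_succ hk, S.up_succ (h.trans hk), ih]

/-- Two cells of the sequence are identified when they become equal at some stage. -/
def setoid : Setoid (Σ n, (S.obj n).Cell) where
  r p q := ∃ (m : ℕ) (h : p.1 ≤ m) (h' : q.1 ≤ m), (S.up m h).map p.2 = (S.up m h').map q.2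
  iseqv :=
    ⟨fun p => ⟨p.1, le_rfl, le_rfl, rfl⟩, fun ⟨m, h, h', e⟩ => ⟨m, h', h, e.symm⟩,
      fun ⟨m, h, h', e⟩ ⟨k, g, g', e'⟩ => ⟨max m k, h.trans (le_max_left _ _),
        g'.trans (le_max_right _ _), by
          rw [← S.up_up h (le_max_left m k), e, S.up_up, ← S.up_up g' (le_max_right m k), ← e',
            S.up_up]⟩⟩

def Colim : Type u := Quotient S.setoid

variable {S}

def ofStage {n : ℕ} (x : (S.obj n).Cell) : S.Colim := Quotient.mk S.setoid ⟨n, x⟩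

theorem mk_up {n m : ℕ} (h : n ≤ m) (x : (S.obj n).Cell) : ofStage ((S.up m h).map x) = ofStage x :=
  Quotient.sound (s := S.setoid) ⟨m, le_rfl, h, by rw [up_self]⟩

theorem mk_eq {n m : ℕ} {x : (S.obj n).Cell} {y : (S.obj m).Cell} :
    ofStage x = ofStage y ↔ ∃ (k : ℕ) (h : n ≤ k) (h' : m ≤ k), (S.up k h).map x = (S.up k h').map y :=
  ⟨fun h => Quotient.exact (s := S.setoid) h, fun h => Quotient.sound (s := S.setoid) h⟩

theorem exists_mk (x : S.Colim) : ∃ (n : ℕ) (a : (S.obj n).Cell), ofStage a = x :=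
  Quotient.inductionOn x fun ⟨n, a⟩ => ⟨n, a, rfl⟩

theorem exists_mk₂ (x y : S.Colim) :
    ∃ (n : ℕ) (a b : (S.obj n).Cell), ofStage a = x ∧ ofStage b = y := by
  obtain ⟨n, a, rfl⟩ := exists_mk x
  obtain ⟨m, b, rfl⟩ := exists_mk y
  exact ⟨max n m, (S.up _ (le_max_left _ _)).map a, (S.up _ (le_max_right _ _)).map b,
    mk_up _ _, mk_up _ _⟩

theorem exists_mk₃ (x y z : S.Colim) :
    ∃ (n : ℕ) (a b c : (S.obj n).Cell), ofStage a = x ∧ ofStage b = y ∧ ofStage c = z := by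
  obtain ⟨n, a, b, rfl, rfl⟩ := exists_mk₂ x y
  obtain ⟨m, c, rfl⟩ := exists_mk z
  exact ⟨max n m, (S.up _ (le_max_left _ _)).map a, (S.up _ (le_max_left _ _)).map b,
    (S.up _ (le_max_right _ _)).map c, mk_up _ _, mk_up _ _, mk_up _ _⟩

variable (S)

def colimDim (x : S.Colim) : ℕ :=
  Quotient.lift (s := S.setoid) (fun p => (S.obj p.1).dim p.2)
    (fun p q ⟨m, h, h', e⟩ => by
      have := congrArg (S.obj m).dim e
      rwa [PrecatHom.dim_map, PrecatHom.dim_map] at this) x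

def colimBd (ε : Bool) (x : S.Colim) : S.Colim :=
  Quotient.lift (s := S.setoid) (fun p => ofStage ((S.obj p.1).bd ε p.2))
    (fun p q ⟨m, h, h', e⟩ => by
      have := congrArg ((S.obj m).bd ε) e
      rw [PrecatHom.bd_map, PrecatHom.bd_map] at this
      exact mk_eq.2 ⟨m, h, h', this⟩) x

def colimOne (x : S.Colim) : S.Colim :=
  Quotient.lift (s := S.setoid) (fun p => ofStage ((S.obj (p.1 + 1)).one ((S.step p.1).map p.2)))
    (fun p q ⟨m, h, h', e⟩ => by
      have key : ∀ (n : ℕ) (a : (S.obj n).Cell) (hn : n ≤ m),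
          (ofStage ((S.obj (n + 1)).one ((S.step n).map a)) : S.Colim) =
            ofStage ((S.obj (m + 1)).one ((S.step m).map ((S.up m hn).map a))) := by
        intro n a hn
        rw [← S.up_succ, ← mk_up (Nat.succ_le_succ hn), PrecatHom.one_map]
        · have e1 : (S.step n).map a = (S.up (n + 1) (Nat.le_succ n)).map a := by
            rw [S.up_succ le_rfl, up_self]
          rw [e1, S.up_up]
        · rw [PrecatHom.dim_map]
          have := (S.obj n).dim_le a
          exact_mod_cast Nat.lt_succ_of_le (by exact_mod_cast this)
      change ofStage _ = ofStage _
      rw [key p.1 p.2 h, key q.1 q.2 h', e]) x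

def colimGlobularSet : GlobularSet.{u} where
  Cell := S.Colim
  dim := S.colimDim
  bd := S.colimBd
  dim_bd ε x := by
    obtain ⟨n, a, rfl⟩ := exists_mk x
    exact (S.obj n).dim_bd ε a
  bd_zero ε x h := by
    obtain ⟨n, a, rfl⟩ := exists_mk x
    exact congrArg ofStage ((S.obj n).bd_zero ε a h)
  globular ε x h := by
    obtain ⟨n, a, rfl⟩ := exists_mk x
    exact congrArg ofStage ((S.obj n).globular ε a h)

theorem colim_bdTo (ε : Bool) (i : ℕ) {n : ℕ} (a : (S.obj n).Cell) :
    S.colimGlobularSet.bdTo ε i (ofStage a) = ofStage ((S.obj n).bdTo ε i a) := by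
  have key : ∀ (d : ℕ) (a : (S.obj n).Cell),
      (S.colimBd ε)^[d] (ofStage a) = ofStage (((S.obj n).bd ε)^[d] a) := by
    intro d
    induction d with
    | zero => exact fun _ => rfl
    | succ d ih => exact fun x => ih ((S.obj n).bd ε x)
  exact key _ a

theorem colim_composable_mk {i n : ℕ} {a b : (S.obj n).Cell} (h : (S.obj n).Composable i a b) :
    S.colimGlobularSet.Composable i (ofStage a) (ofStage b) :=
  ⟨h.1, by rw [colim_bdTo, colim_bdTo, h.2]⟩

theorem colim_composable {i n : ℕ} {a b : (S.obj n).Cell}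
    (h : S.colimGlobularSet.Composable i (ofStage a) (ofStage b)) :
    ∃ (N : ℕ) (_ : n ≤ N), ∀ (m : ℕ) (_ : N ≤ m) (hm : n ≤ m),
      (S.obj m).Composable i ((S.up m hm).map a) ((S.up m hm).map b) := by
  obtain ⟨h1, h2⟩ := h
  rw [colim_bdTo, colim_bdTo] at h2
  obtain ⟨k, hk, hk', e⟩ := mk_eq.1 h2
  refine ⟨k, hk, fun m hm hm' => ⟨?_, ?_⟩⟩
  · rw [PrecatHom.dim_map, PrecatHom.dim_map]
    exact h1
  · rw [PrecatHom.bdTo_map, PrecatHom.bdTo_map, ← S.up_up hk hm, e, S.up_up]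

open Classical in
/-- Composition of cells is computed at any stage where they are composable. -/
noncomputable def colimComp (i : ℕ) (x y : S.Colim) : S.Colim :=
  if h : ∃ (n : ℕ) (p : (S.obj n).Cell × (S.obj n).Cell),
      ofStage p.1 = x ∧ ofStage p.2 = y ∧ (S.obj n).Composable i p.1 p.2 then
    ofStage ((S.obj h.choose).comp i h.choose_spec.choose.1 h.choose_spec.choose.2)
  else x

theorem colimComp_mk {i n : ℕ} {a b : (S.obj n).Cell} (h : (S.obj n).Composable i a b) :
    S.colimComp i (ofStage a) (ofStage b) = ofStage ((S.obj n).comp i a b) := by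
  have hex : ∃ (n' : ℕ) (p : (S.obj n').Cell × (S.obj n').Cell),
      ofStage p.1 = (ofStage a : S.Colim) ∧ ofStage p.2 = (ofStage b : S.Colim) ∧ (S.obj n').Composable i p.1 p.2 :=
    ⟨n, (a, b), rfl, rfl, h⟩
  unfold colimComp
  rw [dif_pos hex]
  obtain ⟨e1, e2, hc⟩ := hex.choose_spec.choose_spec
  obtain ⟨k, hk, hk', e1⟩ := mk_eq.1 e1
  obtain ⟨l, hl, hl', e2⟩ := mk_eq.1 e2
  refine mk_eq.2 ⟨max k l, hk.trans (le_max_left _ _), hk'.trans (le_max_left _ _), ?_⟩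
  rw [PrecatHom.comp_map _ _ _ _ hc, PrecatHom.comp_map _ _ _ _ h]
  congr 1
  · rw [← S.up_up hk (le_max_left _ _), e1, S.up_up]
  · rw [← S.up_up hl (le_max_right _ _), e2, S.up_up]

theorem exists_composable {i : ℕ} {x y : S.Colim} (h : S.colimGlobularSet.Composable i x y) :
    ∃ (n : ℕ) (a b : (S.obj n).Cell), ofStage a = x ∧ ofStage b = y ∧ (S.obj n).Composable i a b := by
  obtain ⟨n, a, b, rfl, rfl⟩ := exists_mk₂ x y
  obtain ⟨N, hN, hc⟩ := S.colim_composable h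
  exact ⟨N, _, _, mk_up hN a, mk_up hN b, hc N le_rfl hN⟩

theorem colimOne_mk {n : ℕ} {a : (S.obj n).Cell} (h : (S.obj n).dim a < n) :
    S.colimOne (ofStage a) = ofStage ((S.obj n).one a) := by
  change ofStage _ = ofStage _
  have e : (S.step n).map a = (S.up (n + 1) (Nat.le_succ n)).map a := by
    rw [S.up_succ le_rfl, up_self]
  rw [e, ← PrecatHom.one_map _ _ (by exact_mod_cast h), mk_up]

theorem exists_stage (x y z : S.Colim) :
    ∃ (n : ℕ) (a b c : (S.obj n).Cell), ofStage a = x ∧ ofStage b = y ∧ ofStage c = z ∧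
      ((S.obj n).dim a < n ∧ (S.obj n).dim b < n) ∧
      (∀ i, S.colimGlobularSet.Composable i x y → (S.obj n).Composable i a b) ∧
      (∀ i, S.colimGlobularSet.Composable i y z → (S.obj n).Composable i b c) ∧
      (∀ i, S.colimGlobularSet.Composable i x z → (S.obj n).Composable i a c) := by
  obtain ⟨n, a, b, c, rfl, rfl, rfl⟩ := exists_mk₃ x y z
  have key : ∀ u v : (S.obj n).Cell, ∃ (N : ℕ) (_ : n ≤ N), ∀ i,
      S.colimGlobularSet.Composable i (ofStage u) (ofStage v) → ∀ (m : ℕ) (_ : N ≤ m) (hm : n ≤ m),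
        (S.obj m).Composable i ((S.up m hm).map u) ((S.up m hm).map v) := by
    intro u v
    by_cases h : ∃ i, S.colimGlobularSet.Composable i (ofStage u) (ofStage v)
    · obtain ⟨i, hi⟩ := h
      obtain ⟨N, hN, hc⟩ := S.colim_composable hi
      refine ⟨N, hN, fun j hj => ?_⟩
      obtain rfl : i = j := by
        have h1 := hi.1
        have h2 := hj.1
        omega
      exact hc
    · exact ⟨n, le_rfl, fun i hi => absurd ⟨i, hi⟩ h⟩
  obtain ⟨N1, h1, k1⟩ := key a b
  obtain ⟨N2, h2, k2⟩ := key b c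
  obtain ⟨N3, h3, k3⟩ := key a c
  obtain ⟨m, hm⟩ : ∃ m, m = N1 + N2 + N3 + (S.obj n).dim a + (S.obj n).dim b + 1 := ⟨_, rfl⟩
  have hnm : n ≤ m := by omega
  refine ⟨m, (S.up m hnm).map a, (S.up m hnm).map b, (S.up m hnm).map c,
    mk_up _ _, mk_up _ _, mk_up _ _, ⟨?_, ?_⟩, fun i hi => k1 i hi m (by omega) hnm,
    fun i hi => k2 i hi m (by omega) hnm, fun i hi => k3 i hi m (by omega) hnm⟩
  · rw [PrecatHom.dim_map]; omega
  · rw [PrecatHom.dim_map]; omega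

/-- The `ω`-precategory obtained as the union of a sequence of `n`-precategories. -/
noncomputable def colim : Precategory.{u} ⊤ where
  toGlobularSet := S.colimGlobularSet
  dim_le _ := le_top
  one := S.colimOne
  comp := S.colimComp
  dim_one x _ := by
    obtain ⟨n, a, _, _, rfl, _, _, ⟨ha, _⟩, _⟩ := S.exists_stage x x x
    rw [S.colimOne_mk ha]
    exact (S.obj n).dim_one a (by exact_mod_cast ha)
  dim_comp i x y h := by
    obtain ⟨n, a, b, rfl, rfl, hab⟩ := S.exists_composable h
    replace h := hab
    rw [S.colimComp_mk h]
    exact (S.obj n).dim_comp i a b h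
  bd_one ε x _ := by
    obtain ⟨n, a, _, _, rfl, _, _, ⟨ha, _⟩, _⟩ := S.exists_stage x x x
    rw [S.colimOne_mk ha]
    exact congrArg ofStage ((S.obj n).bd_one ε a (by exact_mod_cast ha))
  bd_comp_lt ε i x y h hd := by
    obtain ⟨n, a, b, rfl, rfl, hab⟩ := S.exists_composable h
    replace h := hab
    rw [S.colimComp_mk h]
    refine Eq.trans (congrArg ofStage ((S.obj n).bd_comp_lt ε i a b h hd)) ?_
    exact (S.colimComp_mk ((S.obj n).composable_bd_right h hd)).symm
  src_comp i x y h hd := by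
    obtain ⟨n, a, b, rfl, rfl, hab⟩ := S.exists_composable h
    replace h := hab
    rw [S.colimComp_mk h]
    exact congrArg ofStage ((S.obj n).src_comp i a b h hd)
  tgt_comp i x y h hd := by
    obtain ⟨n, a, b, rfl, rfl, hab⟩ := S.exists_composable h
    replace h := hab
    rw [S.colimComp_mk h]
    exact congrArg ofStage ((S.obj n).tgt_comp i a b h hd)
  bd_comp_gt ε i x y h hd := by
    obtain ⟨n, a, b, rfl, rfl, hab⟩ := S.exists_composable h
    replace h := hab
    rw [S.colimComp_mk h]
    refine Eq.trans (congrArg ofStage ((S.obj n).bd_comp_gt ε i a b h hd)) ?_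
    exact (S.colimComp_mk ((S.obj n).composable_bd_left h hd)).symm
  one_comp_le i x y _ h hd := by
    obtain ⟨n, a, b, _, rfl, rfl, _, ⟨ha, _⟩, _⟩ := S.exists_stage x y y
    rw [S.colimOne_mk ha] at h ⊢
    obtain ⟨N, hN, hc⟩ := S.colim_composable h
    replace hc := hc N le_rfl hN
    have ha' : ((S.obj n).dim a : ℕ∞) < n := by exact_mod_cast ha
    rw [← mk_up hN ((S.obj n).one a), ← mk_up hN b, S.colimComp_mk hc]
    rw [PrecatHom.one_map _ _ ha'] at hc ⊢
    refine congrArg ofStage ((S.obj N).one_comp_le _ _ _ ?_ hc ?_)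
    · rw [PrecatHom.dim_map]
      exact lt_of_lt_of_le ha' (by exact_mod_cast hN)
    · rw [PrecatHom.dim_map, PrecatHom.dim_map]
      exact hd
  one_comp_gt i x y _ h hd := by
    obtain ⟨n, a, b, _, rfl, rfl, _, ⟨ha, hb⟩, hc, _⟩ := S.exists_stage x y y
    replace hc := hc i h
    have ha' : ((S.obj n).dim a : ℕ∞) < n := by exact_mod_cast ha
    have hab := (S.obj n).dim_comp _ _ _ hc
    have ho : (S.obj n).Composable i ((S.obj n).one a) b := by
      have h1 := (S.obj n).dim_one a ha'
      have h2 := hc.1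
      have hd' : (S.obj n).dim b < (S.obj n).dim a + 1 := hd
      refine ⟨by omega, ?_⟩
      rw [(S.obj n).bdTo_of_lt (by omega), (S.obj n).bd_one _ _ ha', hc.2]
    rw [S.colimOne_mk ha, S.colimComp_mk ho, S.colimComp_mk hc, S.colimOne_mk (by omega)]
    exact congrArg ofStage ((S.obj n).one_comp_gt i a b ha' hc hd)
  comp_one_le i x y _ h hd := by
    obtain ⟨n, a, b, _, rfl, rfl, _, ⟨_, hb⟩, _⟩ := S.exists_stage x y y
    rw [S.colimOne_mk hb] at h ⊢
    obtain ⟨N, hN, hc⟩ := S.colim_composable h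
    replace hc := hc N le_rfl hN
    have hb' : ((S.obj n).dim b : ℕ∞) < n := by exact_mod_cast hb
    rw [← mk_up hN ((S.obj n).one b), ← mk_up hN a, S.colimComp_mk hc]
    rw [PrecatHom.one_map _ _ hb'] at hc ⊢
    refine congrArg ofStage ((S.obj N).comp_one_le _ _ _ ?_ hc ?_)
    · rw [PrecatHom.dim_map]
      exact lt_of_lt_of_le hb' (by exact_mod_cast hN)
    · rw [PrecatHom.dim_map, PrecatHom.dim_map]
      exact hd
  comp_one_gt i x y _ h hd := by
    obtain ⟨n, a, b, _, rfl, rfl, _, ⟨ha, hb⟩, hc, _⟩ := S.exists_stage x y y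
    replace hc := hc i h
    have hb' : ((S.obj n).dim b : ℕ∞) < n := by exact_mod_cast hb
    have hab := (S.obj n).dim_comp _ _ _ hc
    have ho : (S.obj n).Composable i a ((S.obj n).one b) := by
      have h1 := (S.obj n).dim_one b hb'
      have h2 := hc.1
      have hd' : (S.obj n).dim a < (S.obj n).dim b + 1 := hd
      refine ⟨by omega, ?_⟩
      rw [(S.obj n).bdTo_of_lt (x := (S.obj n).one b) (by omega), (S.obj n).bd_one _ _ hb', hc.2]
    rw [S.colimOne_mk hb, S.colimComp_mk ho, S.colimComp_mk hc, S.colimOne_mk (by omega)]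
    exact congrArg ofStage ((S.obj n).comp_one_gt i a b hb' hc hd)
  assoc i x y z h1 h2 hd := by
    obtain ⟨n, a, b, c, rfl, rfl, rfl, _, hc1, hc2, _⟩ := S.exists_stage x y z
    replace h1 := hc1 i h1
    replace h2 := hc2 i h2
    replace hd : min ((S.obj n).dim a) ((S.obj n).dim c) = i + 1 := hd
    have h3 := h1.1
    have h4 := h2.1
    have e1 : (S.obj n).Composable i ((S.obj n).comp i a b) c :=
      ⟨by rw [(S.obj n).dim_comp _ _ _ h1]; omega, by rw [(S.obj n).bdTo_true_comp h1, h2.2]⟩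
    have e2 : (S.obj n).Composable i a ((S.obj n).comp i b c) :=
      ⟨by rw [(S.obj n).dim_comp _ _ _ h2]; omega, by rw [(S.obj n).bdTo_false_comp h2, h1.2]⟩
    rw [S.colimComp_mk h1, S.colimComp_mk h2, S.colimComp_mk e1, S.colimComp_mk e2]
    exact congrArg ofStage ((S.obj n).assoc i a b c h1 h2 hd)
  comp_distrib i j x y y' hij h1 h2 := by
    obtain ⟨n, a, b, c, rfl, rfl, rfl, _, hc1, hc2, _⟩ := S.exists_stage x y y'
    replace h1 := hc1 i h1
    replace h2 := hc2 j h2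
    have d1 := h1.1
    have d2 := h2.1
    have hl := (S.obj n).bdTo_low (ε := false) hij h2
    have h3 : (S.obj n).Composable i a c := ⟨by omega, by rw [← hl.1]; exact h1.2⟩
    have h4 : (S.obj n).Composable i a ((S.obj n).comp j b c) :=
      ⟨by rw [(S.obj n).dim_comp _ _ _ h2]; omega, by rw [hl.2]; exact h1.2⟩
    have h5 : (S.obj n).Composable j ((S.obj n).comp i a b) ((S.obj n).comp i a c) := by
      refine ⟨by rw [(S.obj n).dim_comp _ _ _ h1, (S.obj n).dim_comp _ _ _ h3]; omega, ?_⟩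
      rw [(S.obj n).bdTo_comp_high_left hij ((S.obj n).dim b - j) (by omega) (by omega) h1,
        (S.obj n).bdTo_comp_high_left hij ((S.obj n).dim c - j) (by omega) (by omega) h3, h2.2]
    rw [S.colimComp_mk h1, S.colimComp_mk h2, S.colimComp_mk h3, S.colimComp_mk h4,
      S.colimComp_mk h5]
    exact congrArg ofStage ((S.obj n).comp_distrib i j a b c hij h1 h2)
  distrib_comp i j x x' y hij h1 h2 := by
    obtain ⟨n, a, b, c, rfl, rfl, rfl, _, hc1, _, hc2⟩ := S.exists_stage x x' y
    replace h1 := hc2 i h1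
    replace h2 := hc1 j h2
    have d1 := h1.1
    have d2 := h2.1
    have hl := (S.obj n).bdTo_low (ε := true) hij h2
    have h3 : (S.obj n).Composable i b c := ⟨by omega, by rw [← hl.1]; exact h1.2⟩
    have h4 : (S.obj n).Composable i ((S.obj n).comp j a b) c :=
      ⟨by rw [(S.obj n).dim_comp _ _ _ h2]; omega, by rw [hl.2]; exact h1.2⟩
    have h5 : (S.obj n).Composable j ((S.obj n).comp i a c) ((S.obj n).comp i b c) := by
      refine ⟨by rw [(S.obj n).dim_comp _ _ _ h1, (S.obj n).dim_comp _ _ _ h3]; omega, ?_⟩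
      rw [(S.obj n).bdTo_comp_high_right hij ((S.obj n).dim a - j) (by omega) (by omega) h1,
        (S.obj n).bdTo_comp_high_right hij ((S.obj n).dim b - j) (by omega) (by omega) h3, h2.2]
    rw [S.colimComp_mk h1, S.colimComp_mk h2, S.colimComp_mk h3, S.colimComp_mk h4,
      S.colimComp_mk h5]
    exact congrArg ofStage ((S.obj n).distrib_comp i j a b c hij h1 h2)

end PrecatSeq

/-- The `0`-precategory on a set. -/
def Precategory.discrete (X : Type u) : Precategory.{u} ((0 : ℕ) : ℕ∞) where
  Cell := X
  dim _ := 0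
  bd _ x := x
  dim_bd _ _ := rfl
  bd_zero _ _ _ := rfl
  globular _ _ _ := rfl
  dim_le _ := le_rfl
  one x := x
  comp _ x _ := x
  dim_one _ h := absurd h (lt_irrefl _)
  dim_comp _ _ _ _ := rfl
  bd_one _ _ _ := rfl
  bd_comp_lt _ _ _ _ _ h := absurd h (lt_irrefl _)
  src_comp _ _ _ _ _ := rfl
  tgt_comp i _ _ h _ := absurd h.1 (Nat.succ_ne_zero i).symm
  bd_comp_gt _ _ _ _ _ h := absurd h (lt_irrefl _)
  one_comp_le _ _ _ h := absurd h (lt_irrefl _)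
  one_comp_gt _ _ _ h := absurd h (lt_irrefl _)
  comp_one_le _ _ _ h := absurd h (lt_irrefl _)
  comp_one_gt _ _ _ h := absurd h (lt_irrefl _)
  assoc _ _ _ _ _ _ _ := rfl
  comp_distrib i j _ _ _ _ h := absurd h.1 (Nat.succ_ne_zero i).symm
  distrib_comp i j _ _ _ _ h := absurd h.1 (Nat.succ_ne_zero i).symm

/-- The type of `n`-polygraphs together with the map sending an `n`-polygraph to the
`n`-precategory it freely generates, by recursion on `n`: a `0`-polygraph is a set, and an
`(n+1)`-polygraph is an `n`-polygraph `P` with a set of `(n+1)`-generators on `P*`. -/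
noncomputable def polygraphWithFree :
    (n : ℕ) → (T : Type (u + 1)) × (T → Precategory.{u} (n : ℕ∞))
  | 0 => ⟨Type u, Precategory.discrete⟩
  | n + 1 => ⟨(P : (polygraphWithFree n).1) × CellExtension ((polygraphWithFree n).2 P),
      fun P => P.2.freeExt⟩

/-- `n`-polygraphs, for `n ∈ ℕ`. -/
def Polygraph (n : ℕ) : Type (u + 1) := (polygraphWithFree.{u} n).1

namespace Polygraph

/-- The free `n`-precategory `P*` on an `n`-polygraph `P`. -/
noncomputable def free {n : ℕ} (P : Polygraph.{u} n) : Precategory.{u} (n : ℕ∞) :=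
  (polygraphWithFree n).2 P

/-- The underlying `n`-polygraph of an `(n+1)`-polygraph. -/
def trunc {n : ℕ} (P : Polygraph.{u} (n + 1)) : Polygraph.{u} n := P.1

/-- The `(n+1)`-generators of an `(n+1)`-polygraph. -/
def gens {n : ℕ} (P : Polygraph.{u} (n + 1)) : CellExtension P.trunc.free := P.2

noncomputable def incl {n : ℕ} (P : Polygraph.{u} (n + 1)) : PrecatHom P.trunc.free P.free :=
  P.gens.incl

end Polygraph

/-- `ω`-polygraphs: the limit of the types of `n`-polygraphs along the truncations. -/
structure OmegaPolygraph where
  poly : ∀ n : ℕ, Polygraph.{u} n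
  trunc_poly : ∀ n : ℕ, (poly (n + 1)).trunc = poly n

namespace OmegaPolygraph

noncomputable def freeSeq (P : OmegaPolygraph.{u}) : PrecatSeq.{u} where
  obj n := (P.poly n).free
  step n := Eq.rec (motive := fun Q _ => PrecatHom Q.free (P.poly (n + 1)).free)
    (P.poly (n + 1)).incl (P.trunc_poly n)

/-- The free `ω`-precategory `P*` on an `ω`-polygraph `P`. -/
noncomputable def free (P : OmegaPolygraph.{u}) : Precategory.{u} ⊤ := P.freeSeq.colim

end OmegaPolygraph

/-! Since no interchange law is imposed, cells of a free extension have rigid normal forms. Let `C`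
be an `n`-precategory and adjoin `(n+1)`-generators. Every new cell is an `•_n`-composite of a list
of whiskered generators, and a whiskered generator is a generator `g` with a context `(l_k, r_k)`
for `k < n`, read as `l_{n-1} •_{n-1} (... (l_0 •_0 (g •_0 r_0)) ...) •_{n-1} r_{n-1}`, where `l_k`
and `r_k` have dimension `k + 1`. The list and the contexts depend only on the cell: `Term.nf`
computes them from a formal composite, and `Rel.nf_eq` says that every axiom preserves them.
Conversely the list, together with the target, determines the cell (`New.mk_eq_of_nf_eq`), because
gluing the list gives the cell back (`Term.nf_spec`). The target is needed because all identities
have the empty list.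

Left composition can be read off normal forms. If `u` is a new cell, composing with another new cell
prepends the list of `u`, and lists can be cancelled on the left. If `u` is a cell of `C` of
dimension `i + 1`, composing with a new cell replaces some of the `l_j` and `r_j` by `u •_i l_j` and
`u •_i r_j`. These whiskers have dimension at most `n`, so cancellation in `C` recovers the context
(`Ctx.lact_injective`). If `u` is new and `v₁`, `v₂` lie in `C`, comparing sources reduces the
question to `C`. Hence left cancellation passes from `C` to its free extension
(`leftCancel_freeExt`). It holds vacuously in dimension `0`, so by induction for every
`n`-polygraph, and it passes to the union because an equality there already holds at a finite stage.
-/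

namespace Precategory

/-! ### Contexts of whiskers and how they act on cells -/

variable {N : ℕ∞} (D : Precategory.{u} N)

/-- Left and right whiskers, one pair for every dimension of composition. -/
@[ext]
structure Ctx where
  l : ℕ → D.Cell
  r : ℕ → D.Cell

variable {D}

theorem composable_of_src_eq {i : ℕ} {x y z : D.Cell} (h : D.Composable i x y)
    (hx : D.dim x = i + 1) (hz : i + 1 ≤ D.dim z) (e : D.bdTo false i y = D.bdTo false i z) :
    D.Composable i x z :=
  ⟨by omega, h.2.trans e⟩

theorem composable_of_tgt_eq {i : ℕ} {x y z : D.Cell} (h : D.Composable i y x)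
    (hx : D.dim x = i + 1) (hz : i + 1 ≤ D.dim z) (e : D.bdTo true i y = D.bdTo true i z) :
    D.Composable i z x :=
  ⟨by omega, e.symm.trans h.2⟩

theorem composable_comp_left {i : ℕ} {x y z : D.Cell} (hxy : D.Composable i x y)
    (hyz : D.Composable i y z) (h : min (D.dim x) (D.dim z) = i + 1) :
    D.Composable i (D.comp i x y) z :=
  ⟨by have := hxy.1; have := hyz.1; rw [D.dim_comp _ _ _ hxy]; omega,
    by rw [D.bdTo_true_comp hxy, hyz.2]⟩

theorem composable_comp_right {i : ℕ} {x y z : D.Cell} (hxy : D.Composable i x y)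
    (hyz : D.Composable i y z) (h : min (D.dim x) (D.dim z) = i + 1) :
    D.Composable i x (D.comp i y z) :=
  ⟨by have := hxy.1; have := hyz.1; rw [D.dim_comp _ _ _ hyz]; omega,
    by rw [D.bdTo_false_comp hyz, hxy.2]⟩

theorem composable_whisker_left {i j : ℕ} (hij : i < j) {x y z : D.Cell} (hx : D.dim x = i + 1)
    (hxy : D.Composable i x y) (hxz : D.Composable i x z) (h : D.Composable j y z) :
    D.Composable j (D.comp i x y) (D.comp i x z) := by
  have := h.1
  refine ⟨by rw [D.dim_comp _ _ _ hxy, D.dim_comp _ _ _ hxz]; omega, ?_⟩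
  rw [D.bdTo_comp_high_left hij (D.dim y - j) (by omega) hx hxy,
    D.bdTo_comp_high_left hij (D.dim z - j) (by omega) hx hxz, h.2]

theorem composable_whisker_right {i j : ℕ} (hij : i < j) {x y z : D.Cell} (hx : D.dim x = i + 1)
    (hyx : D.Composable i y x) (hzx : D.Composable i z x) (h : D.Composable j y z) :
    D.Composable j (D.comp i y x) (D.comp i z x) := by
  have := h.1
  refine ⟨by rw [D.dim_comp _ _ _ hyx, D.dim_comp _ _ _ hzx]; omega, ?_⟩
  rw [D.bdTo_comp_high_right hij (D.dim y - j) (by omega) hx hyx,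
    D.bdTo_comp_high_right hij (D.dim z - j) (by omega) hx hzx, h.2]

namespace Ctx

/-- Whiskering of a cell by the first `k` levels of a context. -/
def app (c : D.Ctx) (a : D.Cell) : ℕ → D.Cell
  | 0 => a
  -- Low dimensions are innermost. A further whisker of dimension `i + 1` therefore distributes over
  -- all levels above `i` and is absorbed at level `i`.
  | k + 1 => D.comp k (c.l k) (D.comp k (c.app a k) (c.r k))

/-- The composites in the definition of `app` are defined. -/
def Valid (c : D.Ctx) (a : D.Cell) : ℕ → Prop
  | 0 => True
  | k + 1 => c.Valid a k ∧ D.Composable k (c.l k) (c.app a k) ∧ D.Composable k (c.app a k) (c.r k)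

/-- The trivial context of a cell. -/
def triv (a : D.Cell) : D.Ctx := ⟨fun k => D.one (D.bdTo false k a), fun k => D.one (D.bdTo true k a)⟩

/-- Precomposition of a context of height `n` with a cell of dimension `i + 1`. -/
def lact (n i : ℕ) (x : D.Cell) (c : D.Ctx) : D.Ctx :=
  -- At level `i` only the left whisker absorbs `x`, by associativity; at levels above `i`
  -- distributivity puts `x` on both sides. Levels from `n` on carry irrelevant values and are left
  -- alone, so that equations between contexts can be honest equalities of functions.
  ⟨fun j => if i ≤ j ∧ j < n then D.comp i x (c.l j) else c.l j,
    fun j => if i < j ∧ j < n then D.comp i x (c.r j) else c.r j⟩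

/-- Postcomposition of a context of height `n` with a cell of dimension `i + 1`. -/
def ract (n i : ℕ) (y : D.Cell) (c : D.Ctx) : D.Ctx :=
  ⟨fun j => if i < j ∧ j < n then D.comp i (c.l j) y else c.l j,
    fun j => if i ≤ j ∧ j < n then D.comp i (c.r j) y else c.r j⟩

variable {c : D.Ctx} {a : D.Cell}

theorem Valid.mono {k k' : ℕ} (h : c.Valid a k') (hk : k ≤ k') : c.Valid a k := by
  induction k', hk using Nat.le_induction with
  | base => exact h
  | succ m _ ih => exact ih h.1

theorem Valid.dim_app : ∀ {k : ℕ}, c.Valid a k → k < D.dim a → D.dim (c.app a k) = D.dim a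
  | 0, _, _ => rfl
  | k + 1, h, hk => by
    have ih := h.1.dim_app (by omega)
    have h1 := h.2.1
    have h2 := h.2.2
    have := h1.1
    have := h2.1
    have h3 := composable_comp_right h1 h2 (by omega)
    rw [app, D.dim_comp _ _ _ h3, D.dim_comp _ _ _ h2]
    omega

/-- The strict inequality matters: the whiskered cell has dimension above `k + 1`, so the minimum in
`Composable` must be attained by the whisker, which pins its dimension. -/
theorem Valid.step {k : ℕ} (h : c.Valid a (k + 1)) (hk : k + 1 < D.dim a) :
    D.dim (c.l k) = k + 1 ∧ D.dim (c.r k) = k + 1 ∧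
      D.Composable k (c.l k) (D.comp k (c.app a k) (c.r k)) := by
  have ih := h.1.dim_app (by omega)
  have h1 := h.2.1
  have h2 := h.2.2
  have := h1.1
  have := h2.1
  exact ⟨by omega, by omega, composable_comp_right h1 h2 (by omega)⟩

theorem Valid.dim_l {k j : ℕ} (h : c.Valid a k) (hk : k < D.dim a) (hj : j < k) :
    D.dim (c.l j) = j + 1 := ((h.mono hj).step (by omega)).1

theorem Valid.dim_r {k j : ℕ} (h : c.Valid a k) (hk : k < D.dim a) (hj : j < k) :
    D.dim (c.r j) = j + 1 := ((h.mono hj).step (by omega)).2.1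

/-- Composition along dimension `k` does not affect boundaries of dimension below `k`, and its
factors share them. -/
theorem Valid.bdTo_step {k i : ℕ} (h : c.Valid a (k + 1)) (hk : k + 1 < D.dim a) (hi : i < k)
    (ε : Bool) : D.bdTo ε i (c.app a (k + 1)) = D.bdTo ε i (c.l k) ∧
      D.bdTo ε i (c.app a (k + 1)) = D.bdTo ε i (c.app a k) ∧
      D.bdTo ε i (c.app a (k + 1)) = D.bdTo ε i (c.r k) := by
  obtain ⟨h1, h2, h3⟩ := h.step hk
  have e1 := D.bdTo_low (ε := ε) hi h3
  have e2 := D.bdTo_low (ε := ε) hi h.2.2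
  have e3 : D.bdTo ε i (c.app a (k + 1)) = D.bdTo ε i (c.l k) := e1.2
  exact ⟨e3, by rw [e3, e1.1, e2.2], by rw [e3, e1.1, e2.2, e2.1]⟩

theorem Valid.bdTo_app {k j i : ℕ} (h : c.Valid a k) (hk : k < D.dim a) (hj : j ≤ k) (hi : i < j)
    (ε : Bool) : D.bdTo ε i (c.app a k) = D.bdTo ε i (c.app a j) := by
  induction k, hj using Nat.le_induction with
  | base => rfl
  | succ m hm ih => rw [(h.bdTo_step hk (by omega) ε).2.1, ih h.1 (by omega)]

theorem Valid.bdTo_l {k j i : ℕ} (h : c.Valid a k) (hk : k < D.dim a) (hj : j < k) (hi : i < j)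
    (ε : Bool) : D.bdTo ε i (c.app a k) = D.bdTo ε i (c.l j) := by
  rw [h.bdTo_app hk (j := j + 1) hj (by omega), ((h.mono hj).bdTo_step (by omega) hi ε).1]

theorem Valid.bdTo_r {k j i : ℕ} (h : c.Valid a k) (hk : k < D.dim a) (hj : j < k) (hi : i < j)
    (ε : Bool) : D.bdTo ε i (c.app a k) = D.bdTo ε i (c.r j) := by
  rw [h.bdTo_app hk (j := j + 1) hj (by omega), ((h.mono hj).bdTo_step (by omega) hi ε).2.2]

/-- The case `i = j` is special to sources: `l_j` is the first factor at its level. For `r_j` the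
same holds for targets, which is the asymmetry seen in `lact` and `ract`. -/
theorem Valid.src_l {k j i : ℕ} (h : c.Valid a k) (hk : k < D.dim a) (hj : j < k) (hi : i ≤ j) :
    D.bdTo false i (c.app a k) = D.bdTo false i (c.l j) := by
  rcases hi.lt_or_eq with hi | rfl
  · exact h.bdTo_l hk hj hi _
  · rw [h.bdTo_app hk (j := i + 1) hj (by omega), app,
      D.bdTo_false_comp ((h.mono hj).step (by omega)).2.2]

theorem Valid.tgt_r {k j i : ℕ} (h : c.Valid a k) (hk : k < D.dim a) (hj : j < k) (hi : i ≤ j) :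
    D.bdTo true i (c.app a k) = D.bdTo true i (c.r j) := by
  rcases hi.lt_or_eq with hi | rfl
  · exact h.bdTo_r hk hj hi _
  · rw [h.bdTo_app hk (j := i + 1) hj (by omega), app,
      D.bdTo_true_comp ((h.mono hj).step (by omega)).2.2, D.bdTo_true_comp (h.mono hj).2.2]

section

variable {n i : ℕ} {x y : D.Cell}

/-- This lemma and the next five transfer composability from the whole whiskered cell to each piece
of its context; they make the components of `lact` and `ract` meaningful. -/
theorem Valid.left_l (h : c.Valid a n) (hn : n < D.dim a) (hx : D.Composable i x (c.app a n))
    (hd : D.dim x = i + 1) {j : ℕ} (hij : i ≤ j) (hj : j < n) : D.Composable i x (c.l j) :=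
  composable_of_src_eq hx hd (by rw [h.dim_l hn hj]; omega) (h.src_l hn hj hij)

theorem Valid.left_r (h : c.Valid a n) (hn : n < D.dim a) (hx : D.Composable i x (c.app a n))
    (hd : D.dim x = i + 1) {j : ℕ} (hij : i < j) (hj : j < n) : D.Composable i x (c.r j) :=
  composable_of_src_eq hx hd (by rw [h.dim_r hn hj]; omega) (h.bdTo_r hn hj hij _)

theorem Valid.left_app (h : c.Valid a n) (hn : n < D.dim a) (hx : D.Composable i x (c.app a n))
    (hd : D.dim x = i + 1) {j : ℕ} (hij : i < j) (hj : j ≤ n) : D.Composable i x (c.app a j) :=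
  composable_of_src_eq hx hd (by rw [(h.mono hj).dim_app (by omega)]; omega) (h.bdTo_app hn hj hij _)

theorem Valid.right_r (h : c.Valid a n) (hn : n < D.dim a) (hy : D.Composable i (c.app a n) y)
    (hd : D.dim y = i + 1) {j : ℕ} (hij : i ≤ j) (hj : j < n) : D.Composable i (c.r j) y :=
  composable_of_tgt_eq hy hd (by rw [h.dim_r hn hj]; omega) (h.tgt_r hn hj hij)

theorem Valid.right_l (h : c.Valid a n) (hn : n < D.dim a) (hy : D.Composable i (c.app a n) y)
    (hd : D.dim y = i + 1) {j : ℕ} (hij : i < j) (hj : j < n) : D.Composable i (c.l j) y :=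
  composable_of_tgt_eq hy hd (by rw [h.dim_l hn hj]; omega) (h.bdTo_l hn hj hij _)

theorem Valid.right_app (h : c.Valid a n) (hn : n < D.dim a) (hy : D.Composable i (c.app a n) y)
    (hd : D.dim y = i + 1) {j : ℕ} (hij : i < j) (hj : j ≤ n) : D.Composable i (c.app a j) y :=
  composable_of_tgt_eq hy hd (by rw [(h.mono hj).dim_app (by omega)]; omega) (h.bdTo_app hn hj hij _)

theorem lact_low (k : ℕ) (hk : k ≤ i) (h : c.Valid a k) :
    (lact n i x c).Valid a k ∧ (lact n i x c).app a k = c.app a k := by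
  induction k with
  | zero => exact ⟨trivial, rfl⟩
  | succ k ih =>
    obtain ⟨h1, h2⟩ := ih (by omega) h.1
    have e1 : (lact n i x c).l k = c.l k := if_neg (by omega)
    have e2 : (lact n i x c).r k = c.r k := if_neg (by omega)
    simp only [Valid, app, e1, e2, h2]
    exact ⟨⟨h1, h.2⟩, trivial⟩

theorem ract_low (k : ℕ) (hk : k ≤ i) (h : c.Valid a k) :
    (ract n i x c).Valid a k ∧ (ract n i x c).app a k = c.app a k := by
  induction k with
  | zero => exact ⟨trivial, rfl⟩
  | succ k ih =>
    obtain ⟨h1, h2⟩ := ih (by omega) h.1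
    have e1 : (ract n i x c).l k = c.l k := if_neg (by omega)
    have e2 : (ract n i x c).r k = c.r k := if_neg (by omega)
    simp only [Valid, app, e1, e2, h2]
    exact ⟨⟨h1, h.2⟩, trivial⟩

/-- Justifies the definition of `lact`: associativity handles level `i`, and distributivity, used
twice, handles each higher level. -/
theorem lact_app (h : c.Valid a n) (hn : n < D.dim a) (hx : D.Composable i x (c.app a n))
    (hd : D.dim x = i + 1) {k : ℕ} (hk : i + 1 ≤ k) (hkn : k ≤ n) :
    (lact n i x c).Valid a k ∧ (lact n i x c).app a k = D.comp i x (c.app a k) := by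
  induction k, hk using Nat.le_induction with
  | base =>
    have hv := h.mono hkn
    -- Levels below `i` sit inside level `i` and never meet `x`.
    obtain ⟨h1, h2⟩ := lact_low (n := n) (i := i) (x := x) i le_rfl hv.1
    obtain ⟨d1, d2, h3⟩ := hv.step (by omega)
    have e1 : (lact n i x c).l i = D.comp i x (c.l i) := if_pos (by omega)
    have e2 : (lact n i x c).r i = c.r i := if_neg (by omega)
    have hl := h.left_l hn hx hd (le_refl i) (by omega)
    have := hv.1.dim_app (by omega)
    simp only [Valid, app, e1, e2, h2]
    exact ⟨⟨h1, composable_comp_left hl hv.2.1 (by omega), hv.2.2⟩,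
      D.assoc _ _ _ _ hl h3 (by rw [D.dim_comp _ _ _ hv.2.2]; omega)⟩
  | succ k hk ih =>
    obtain ⟨h1, h2⟩ := ih (by omega)
    have hv := h.mono hkn
    obtain ⟨d1, d2, h3⟩ := hv.step (by omega)
    have e1 : (lact n i x c).l k = D.comp i x (c.l k) := if_pos (by omega)
    have e2 : (lact n i x c).r k = D.comp i x (c.r k) := if_pos (by omega)
    have hl := h.left_l hn hx hd (j := k) (by omega) (by omega)
    have hr := h.left_r hn hx hd (j := k) (by omega) (by omega)
    have ha := h.left_app hn hx hd (j := k) (by omega) (by omega)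
    simp only [Valid, app, e1, e2, h2]
    refine ⟨⟨h1, composable_whisker_left (by omega) hd hl ha hv.2.1,
      composable_whisker_left (by omega) hd ha hr hv.2.2⟩, ?_⟩
    rw [← D.comp_distrib _ _ _ _ _ (by omega) ha hv.2.2,
      ← D.comp_distrib _ _ _ _ _ (by omega) hl h3]

theorem ract_app (h : c.Valid a n) (hn : n < D.dim a) (hy : D.Composable i (c.app a n) y)
    (hd : D.dim y = i + 1) {k : ℕ} (hk : i + 1 ≤ k) (hkn : k ≤ n) :
    (ract n i y c).Valid a k ∧ (ract n i y c).app a k = D.comp i (c.app a k) y := by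
  induction k, hk using Nat.le_induction with
  | base =>
    have hv := h.mono hkn
    obtain ⟨h1, h2⟩ := ract_low (n := n) (i := i) (x := y) i le_rfl hv.1
    obtain ⟨d1, d2, h3⟩ := hv.step (by omega)
    have e1 : (ract n i y c).l i = c.l i := if_neg (by omega)
    have e2 : (ract n i y c).r i = D.comp i (c.r i) y := if_pos (by omega)
    have hr := h.right_r hn hy hd (le_refl i) (by omega)
    have := hv.1.dim_app (by omega)
    have h4 := composable_comp_left hv.2.2 hr (by omega)
    simp only [Valid, app, e1, e2, h2]
    refine ⟨⟨h1, hv.2.1, composable_comp_right hv.2.2 hr (by omega)⟩, ?_⟩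
    rw [← D.assoc _ _ _ _ hv.2.2 hr (by omega), ← D.assoc _ _ _ _ h3 h4 (by omega)]
  | succ k hk ih =>
    obtain ⟨h1, h2⟩ := ih (by omega)
    have hv := h.mono hkn
    obtain ⟨d1, d2, h3⟩ := hv.step (by omega)
    have e1 : (ract n i y c).l k = D.comp i (c.l k) y := if_pos (by omega)
    have e2 : (ract n i y c).r k = D.comp i (c.r k) y := if_pos (by omega)
    have hl := h.right_l hn hy hd (j := k) (by omega) (by omega)
    have hr := h.right_r hn hy hd (j := k) (by omega) (by omega)
    have ha := h.right_app hn hy hd (j := k) (by omega) (by omega)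
    simp only [Valid, app, e1, e2, h2]
    refine ⟨⟨h1, composable_whisker_right (by omega) hd hl ha hv.2.1,
      composable_whisker_right (by omega) hd ha hr hv.2.2⟩, ?_⟩
    rw [← D.distrib_comp _ _ _ _ _ (by omega) ha hv.2.2,
      ← D.distrib_comp _ _ _ _ _ (by omega) hl h3]

end

end Ctx

end Precategory

/-! ### The precategory axioms as identities between contexts -/

namespace Precategory

variable {N : ℕ∞} {D : Precategory.{u} N}

theorem dim_bdTo {ε : Bool} {i : ℕ} {x : D.Cell} (h : i ≤ D.dim x) : D.dim (D.bdTo ε i x) = i := by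
  obtain ⟨d, hd⟩ := Nat.exists_eq_add_of_le h
  induction d generalizing x with
  | zero => rw [D.bdTo_self (by omega)]; omega
  | succ d ih =>
    have := D.dim_bd ε x
    rw [D.bdTo_of_lt (by omega)]
    exact ih (by omega) (by omega)

theorem bdTo_one {ε : Bool} {x : D.Cell} (h : (D.dim x : ℕ∞) < N) :
    D.bdTo ε (D.dim x) (D.one x) = x := by
  rw [D.bdTo_of_lt (by rw [D.dim_one x h]; omega), D.bd_one _ _ h, D.bdTo_self le_rfl]

namespace Ctx

variable {n i j : ℕ} {c : D.Ctx} {a x y w : D.Cell}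

/-- A bare generator also needs a whisker at every level; identities on its iterated boundaries
serve, and the unit laws remove them. -/
theorem triv_app (a : D.Cell) {k : ℕ} (hk : k ≤ D.dim a) :
    (triv a).Valid a k ∧ (triv a).app a k = a := by
  induction k with
  | zero => exact ⟨trivial, rfl⟩
  | succ k ih =>
    obtain ⟨h1, h2⟩ := ih (by omega)
    have hN : ∀ ε, (D.dim (D.bdTo ε k a) : ℕ∞) < N := fun ε => by
      rw [dim_bdTo (by omega)]
      exact lt_of_lt_of_le (by exact_mod_cast hk) (D.dim_le a)
    have hd : ∀ ε, D.dim (D.bdTo ε k a) = k := fun ε => dim_bdTo (by omega)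
    have hl : D.Composable k (D.one (D.bdTo false k a)) a := by
      refine ⟨by rw [D.dim_one _ (hN _), hd]; omega, ?_⟩
      have := bdTo_one (ε := true) (hN false)
      rwa [hd] at this
    have hr : D.Composable k a (D.one (D.bdTo true k a)) := by
      refine ⟨by rw [D.dim_one _ (hN _), hd]; omega, ?_⟩
      have := bdTo_one (ε := false) (hN true)
      rw [hd] at this
      exact this.symm
    have e1 : (triv a).l k = D.one (D.bdTo false k a) := rfl
    have e2 : (triv a).r k = D.one (D.bdTo true k a) := rfl
    simp only [Valid, app, h2, e1, e2]
    refine ⟨⟨h1, hl, hr⟩, ?_⟩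
    rw [D.comp_one_le _ _ _ (hN _) hr (by rw [hd]; omega),
      D.one_comp_le _ _ _ (hN _) hl (by rw [hd]; omega)]

/-- From here to `ract_ract`, each lemma is what one whiskering axiom of `Rel` becomes on contexts.
All are checked level by level, where the same axiom is applied to whiskers instead of to new cells.
The right action is needed even for left cancellation, since normal forms must respect all axioms.
-/
theorem lact_one (h : c.Valid a n) (hn : n < D.dim a) (hw : (D.dim w : ℕ∞) < N) (hd : D.dim w = i)
    (hx : D.Composable i (D.one w) (c.app a n)) : lact n i (D.one w) c = c := by
  have hd' : D.dim (D.one w) = i + 1 := by rw [D.dim_one _ hw, hd]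
  ext k <;> simp only [lact] <;> split_ifs with hk
  · exact D.one_comp_le _ _ _ hw (h.left_l hn hx hd' hk.1 hk.2) (by rw [h.dim_l hn hk.2]; omega)
  · rfl
  · exact D.one_comp_le _ _ _ hw (h.left_r hn hx hd' hk.1 hk.2) (by rw [h.dim_r hn hk.2]; omega)
  · rfl

theorem ract_one (h : c.Valid a n) (hn : n < D.dim a) (hw : (D.dim w : ℕ∞) < N) (hd : D.dim w = i)
    (hy : D.Composable i (c.app a n) (D.one w)) : ract n i (D.one w) c = c := by
  have hd' : D.dim (D.one w) = i + 1 := by rw [D.dim_one _ hw, hd]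
  ext k <;> simp only [ract] <;> split_ifs with hk
  · exact D.comp_one_le _ _ _ hw (h.right_l hn hy hd' hk.1 hk.2) (by rw [h.dim_l hn hk.2]; omega)
  · rfl
  · exact D.comp_one_le _ _ _ hw (h.right_r hn hy hd' hk.1 hk.2) (by rw [h.dim_r hn hk.2]; omega)
  · rfl

theorem lact_comp (h : c.Valid a n) (hn : n < D.dim a) (hx : D.dim x = i + 1)
    (hy : D.dim y = i + 1) (hxy : D.Composable i x y) (hc : D.Composable i y (c.app a n)) :
    lact n i (D.comp i x y) c = lact n i x (lact n i y c) := by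
  ext k <;> simp only [lact] <;> split_ifs with hk
  · exact D.assoc _ _ _ _ hxy (h.left_l hn hc hy hk.1 hk.2) (by rw [h.dim_l hn hk.2]; omega)
  · rfl
  · exact D.assoc _ _ _ _ hxy (h.left_r hn hc hy hk.1 hk.2) (by rw [h.dim_r hn hk.2]; omega)
  · rfl

theorem ract_comp (h : c.Valid a n) (hn : n < D.dim a) (hx : D.dim x = i + 1)
    (hy : D.dim y = i + 1) (hxy : D.Composable i x y) (hc : D.Composable i (c.app a n) x) :
    ract n i y (ract n i x c) = ract n i (D.comp i x y) c := by
  ext k <;> simp only [ract] <;> split_ifs with hk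
  · exact D.assoc _ _ _ _ (h.right_l hn hc hx hk.1 hk.2) hxy (by rw [h.dim_l hn hk.2]; omega)
  · rfl
  · exact D.assoc _ _ _ _ (h.right_r hn hc hx hk.1 hk.2) hxy (by rw [h.dim_r hn hk.2]; omega)
  · rfl

theorem ract_lact (h : c.Valid a n) (hn : n < D.dim a) (hx : D.dim x = i + 1)
    (hy : D.dim y = i + 1) (hxc : D.Composable i x (c.app a n))
    (hcy : D.Composable i (c.app a n) y) :
    ract n i y (lact n i x c) = lact n i x (ract n i y c) := by
  -- Levels where at most one action is active agree definitionally and inconsistent index ranges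
  -- are discarded; only levels met by both actions remain.
  ext k <;> simp only [lact, ract] <;> split_ifs <;> try first | rfl | omega
  · exact D.assoc _ _ _ _ (h.left_l hn hxc hx (by omega) (by omega))
      (h.right_l hn hcy hy (by omega) (by omega)) (by omega)
  · exact D.assoc _ _ _ _ (h.left_r hn hxc hx (by omega) (by omega))
      (h.right_r hn hcy hy (by omega) (by omega)) (by omega)

theorem lact_lact (hij : i < j) (h : c.Valid a n) (hn : n < D.dim a)
    (hy : D.dim y = j + 1) (hxy : D.Composable i x y) (hc : D.Composable j y (c.app a n)) :
    lact n i x (lact n j y c) = lact n j (D.comp i x y) (lact n i x c) := by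
  ext k <;> simp only [lact] <;> split_ifs <;> try first | rfl | omega
  · exact D.comp_distrib _ _ _ _ _ hij hxy (h.left_l hn hc hy (by omega) (by omega))
  · exact D.comp_distrib _ _ _ _ _ hij hxy (h.left_r hn hc hy (by omega) (by omega))

theorem lact_ract (hij : i < j) (h : c.Valid a n) (hn : n < D.dim a) (hx : D.dim x = i + 1)
    (hy : D.dim y = j + 1) (hxc : D.Composable i x (c.app a n))
    (hc : D.Composable j (c.app a n) y) :
    lact n i x (ract n j y c) = ract n j (D.comp i x y) (lact n i x c) := by
  ext k <;> simp only [lact, ract] <;> split_ifs <;> try first | rfl | omega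
  · exact D.comp_distrib _ _ _ _ _ hij (h.left_l hn hxc hx (by omega) (by omega))
      (h.right_l hn hc hy (by omega) (by omega))
  · exact D.comp_distrib _ _ _ _ _ hij (h.left_r hn hxc hx (by omega) (by omega))
      (h.right_r hn hc hy (by omega) (by omega))

theorem ract_lact_lt (hij : i < j) (h : c.Valid a n) (hn : n < D.dim a)
    (hx : D.dim x = j + 1) (hxy : D.Composable i x y) (hc : D.Composable j x (c.app a n)) :
    ract n i y (lact n j x c) = lact n j (D.comp i x y) (ract n i y c) := by
  ext k <;> simp only [lact, ract] <;> split_ifs <;> try first | rfl | omega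
  · exact D.distrib_comp _ _ _ _ _ hij hxy (h.left_l hn hc hx (by omega) (by omega))
  · exact D.distrib_comp _ _ _ _ _ hij hxy (h.left_r hn hc hx (by omega) (by omega))

theorem ract_ract (hij : i < j) (h : c.Valid a n) (hn : n < D.dim a) (hx : D.dim x = j + 1)
    (hy : D.dim y = i + 1) (hcy : D.Composable i (c.app a n) y)
    (hc : D.Composable j (c.app a n) x) :
    ract n i y (ract n j x c) = ract n j (D.comp i x y) (ract n i y c) := by
  ext k <;> simp only [ract] <;> split_ifs <;> try first | rfl | omega
  · exact D.distrib_comp _ _ _ _ _ hij (h.right_l hn hcy hy (by omega) (by omega))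
      (h.right_l hn hc hx (by omega) (by omega))
  · exact D.distrib_comp _ _ _ _ _ hij (h.right_r hn hcy hy (by omega) (by omega))
      (h.right_r hn hc hx (by omega) (by omega))

/-- Cancellation is assumed only for cells of dimension at most `n`, which is enough because every
whisker has such a dimension. This is what lets the induction on dimension go through. Untouched
components, including those at levels from `n` on, agree outright. -/
theorem lact_injective {c' : D.Ctx} {a' : D.Cell} (h : c.Valid a n) (hn : n < D.dim a)
    (h' : c'.Valid a' n) (hn' : n < D.dim a') (hx : D.dim x = i + 1)
    (hc : D.Composable i x (c.app a n)) (hc' : D.Composable i x (c'.app a' n))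
    (hx_can : ∀ y y', D.dim y ≤ n → D.dim y' ≤ n → D.Composable i x y → D.Composable i x y' →
      D.comp i x y = D.comp i x y' → y = y')
    (e : lact n i x c = lact n i x c') : c = c' := by
  ext k
  · have ek := congrFun (congrArg Ctx.l e) k
    simp only [lact] at ek
    split_ifs at ek with hk
    · exact hx_can _ _ (by rw [h.dim_l hn hk.2]; omega) (by rw [h'.dim_l hn' hk.2]; omega)
        (h.left_l hn hc hx hk.1 hk.2) (h'.left_l hn' hc' hx hk.1 hk.2) ek
    · exact ek
  · have ek := congrFun (congrArg Ctx.r e) k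
    simp only [lact] at ek
    split_ifs at ek with hk
    · exact hx_can _ _ (by rw [h.dim_r hn hk.2]; omega) (by rw [h'.dim_r hn' hk.2]; omega)
        (h.left_r hn hc hx hk.1 hk.2) (h'.left_r hn' hc' hx hk.1 hk.2) ek
    · exact ek

end Ctx

/-! ### Paths of whiskered cells and their composites -/

/-- A whiskered cell, presented by a cell and a context. -/
abbrev Atom (D : Precategory.{u} N) := D.Cell × D.Ctx

/-- `L` is a composable path of whiskered `(n+1)`-cells from `s` to `t`. -/
def IsPath (n : ℕ) : List D.Atom → D.Cell → D.Cell → Prop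
  | [], s, t => s = t ∧ D.dim s = n
  | A :: L, s, t => D.dim A.1 = n + 1 ∧ A.2.Valid A.1 n ∧ D.bd false (A.2.app A.1 n) = s ∧
      IsPath n L (D.bd true (A.2.app A.1 n)) t

/-- The composite of a path with target `t`. -/
def glue (n : ℕ) (t : D.Cell) : List D.Atom → D.Cell
  -- The empty list does not remember where it lives, hence the explicit target; every composite
  -- formally ends with the identity on `t`.
  | [] => D.one t
  | A :: L => D.comp n (A.2.app A.1 n) (glue n t L)

namespace IsPath

variable {n : ℕ} {L L' : List D.Atom} {s t t' : D.Cell}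

theorem dim_src (h : IsPath n L s t) : D.dim s = n := by
  cases L with
  | nil => exact h.2
  | cons A L =>
    obtain ⟨h1, h2, h3, _⟩ := h
    rw [← h3, D.dim_bd, h2.dim_app (by omega), h1]
    rfl

theorem composable_of_bd {y z : D.Cell} (hy : D.dim y = n + 1) (hz : D.dim z = n + 1)
    (h : D.bd true y = D.bd false z) : D.Composable n y z := by
  refine ⟨by omega, ?_⟩
  rw [D.bdTo_of_lt (x := y) (by omega), D.bdTo_of_lt (x := z) (by omega), h,
    D.bdTo_self (by rw [D.dim_bd]; omega), D.bdTo_self (by rw [D.dim_bd]; omega)]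

theorem glue_spec (hN : (n : ℕ∞) < N) (h : IsPath n L s t) :
    D.dim (glue n t L) = n + 1 ∧ D.bd false (glue n t L) = s ∧ D.bd true (glue n t L) = t := by
  induction L generalizing s with
  | nil =>
    obtain ⟨rfl, rfl⟩ := h
    exact ⟨D.dim_one _ hN, D.bd_one _ _ hN, D.bd_one _ _ hN⟩
  | cons A L ih =>
    obtain ⟨h1, h2, h3, h4⟩ := h
    obtain ⟨e1, e2, e3⟩ := ih h4
    have hd := h2.dim_app (by omega)
    have hc := composable_of_bd (hd.trans h1) e1 e2.symm
    refine ⟨?_, ?_, ?_⟩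
    · rw [glue, D.dim_comp _ _ _ hc]; omega
    · rw [glue, D.src_comp _ _ _ hc (by omega), h3]
    · rw [glue, D.tgt_comp _ _ _ hc (by omega), e3]

theorem append (h : IsPath n L s t) (h' : IsPath n L' t t') : IsPath n (L ++ L') s t' := by
  induction L generalizing s with
  | nil => obtain ⟨rfl, _⟩ := h; exact h'
  | cons A L ih => exact ⟨h.1, h.2.1, h.2.2.1, ih h.2.2.2⟩

/-- The identity that ends the first composite is absorbed by the unit law; the rest is
associativity. -/
theorem glue_append (hN : (n : ℕ∞) < N) (h : IsPath n L s t) (h' : IsPath n L' t t') :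
    glue n t' (L ++ L') = D.comp n (glue n t L) (glue n t' L') := by
  obtain ⟨f1, f2, f3⟩ := h'.glue_spec hN
  induction L generalizing s with
  | nil =>
    have ht : D.dim t = n := h'.dim_src
    have ht' : (D.dim t : ℕ∞) < N := by rw [ht]; exact hN
    rw [List.nil_append, glue]
    refine (D.one_comp_le _ _ _ ht' ?_ (by omega)).symm
    refine composable_of_bd (by rw [D.dim_one _ ht', ht]) f1 ?_
    rw [D.bd_one _ _ ht', f2]
  | cons A L ih =>
    obtain ⟨h1, h2, h3, h4⟩ := h
    obtain ⟨e1, e2, e3⟩ := h4.glue_spec hN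
    have hd := h2.dim_app (by omega)
    have hc := composable_of_bd (hd.trans h1) e1 e2.symm
    rw [List.cons_append, glue, ih h4, glue]
    exact (D.assoc _ _ _ _ hc (composable_of_bd e1 f1 (e3.trans f2.symm)) (by omega)).symm

/-- All atoms of a path have the same boundaries below dimension `n`, since the vertices of the path
are parallel `n`-cells. So a whisker that fits the source `s` fits every atom, as `left` and `right`
record. -/
theorem mem {A : D.Atom} (h : IsPath n L s t) (hA : A ∈ L) :
    D.dim A.1 = n + 1 ∧ A.2.Valid A.1 n ∧
      ∀ ε i, i < n → D.bdTo ε i (A.2.app A.1 n) = D.bdTo ε i s := by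
  induction L generalizing s with
  | nil => simp at hA
  | cons B L ih =>
    obtain ⟨h1, h2, h3, h4⟩ := h
    have hd := h2.dim_app (by omega)
    rcases List.mem_cons.1 hA with rfl | hA
    · exact ⟨h1, h2, fun ε i hi => by rw [← h3, D.bdTo_bd (by omega)]⟩
    · obtain ⟨g1, g2, g3⟩ := ih h4 hA
      refine ⟨g1, g2, fun ε i hi => ?_⟩
      rw [g3 ε i hi, ← h3, D.bdTo_bd (by omega), D.bdTo_bd (by omega)]

theorem left {i : ℕ} {x : D.Cell} {A : D.Atom} (h : IsPath n L s t) (hA : A ∈ L)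
    (hx : D.Composable i x s) (hi : i < n) (hd : D.dim x = i + 1) :
    D.Composable i x (A.2.app A.1 n) := by
  obtain ⟨g1, g2, g3⟩ := h.mem hA
  have := h.dim_src
  have := g2.dim_app (by omega)
  have := hx.1
  exact ⟨by omega, hx.2.trans (g3 _ _ hi).symm⟩

theorem right {i : ℕ} {x : D.Cell} {A : D.Atom} (h : IsPath n L s t) (hA : A ∈ L)
    (hx : D.Composable i s x) (hi : i < n) (hd : D.dim x = i + 1) :
    D.Composable i (A.2.app A.1 n) x := by
  obtain ⟨g1, g2, g3⟩ := h.mem hA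
  have := h.dim_src
  have := g2.dim_app (by omega)
  exact ⟨by omega, (g3 _ _ hi).trans hx.2⟩

/-- As `i < n`, whiskering distributes over the `•_n`-composite, and it sends the final identity to
an identity. Thus it acts atom by atom. -/
theorem map_lact {i : ℕ} {x : D.Cell} (hN : (n : ℕ∞) < N) (h : IsPath n L s t)
    (hx : D.Composable i x s) (hi : i < n) (hd : D.dim x = i + 1) :
    D.Composable i x t ∧
    IsPath n (L.map (Prod.map id (Ctx.lact n i x))) (D.comp i x s) (D.comp i x t) ∧
      glue n (D.comp i x t) (L.map (Prod.map id (Ctx.lact n i x))) =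
        D.comp i x (glue n t L) := by
  induction L generalizing s with
  | nil =>
    obtain ⟨rfl, hs⟩ := h
    refine ⟨hx, ⟨rfl, by rw [D.dim_comp _ _ _ hx]; omega⟩, ?_⟩
    exact (D.comp_one_gt _ _ _ (by rw [hs]; exact hN) hx (by omega)).symm
  | cons A L ih =>
    have hA := h.left List.mem_cons_self hx hi hd
    obtain ⟨h1, h2, rfl, h4⟩ := h
    have hdA := h2.dim_app (by omega)
    obtain ⟨v1, v2⟩ := Ctx.lact_app h2 (by omega) hA hd hi le_rfl
    obtain ⟨g1, g2, g3⟩ := ih h4 (composable_bd_right D hA (by omega))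
    obtain ⟨e1, e2, e3⟩ := h4.glue_spec hN
    refine ⟨g1, ⟨h1, v1, ?_, ?_⟩, ?_⟩
    · simp only [Prod.map, id]
      rw [v2, D.bd_comp_lt _ _ _ _ hA (by omega)]
    · simp only [Prod.map, id]
      rw [v2, D.bd_comp_lt _ _ _ _ hA (by omega)]
      exact g2
    · rw [List.map_cons, glue, g3, glue]
      simp only [Prod.map, id]
      rw [v2]
      exact (D.comp_distrib _ _ _ _ _ hi hA
        (composable_of_bd (hdA.trans h1) e1 e2.symm)).symm

theorem map_ract {i : ℕ} {y : D.Cell} (hN : (n : ℕ∞) < N) (h : IsPath n L s t)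
    (hy : D.Composable i s y) (hi : i < n) (hd : D.dim y = i + 1) :
    D.Composable i t y ∧
    IsPath n (L.map (Prod.map id (Ctx.ract n i y))) (D.comp i s y) (D.comp i t y) ∧
      glue n (D.comp i t y) (L.map (Prod.map id (Ctx.ract n i y))) =
        D.comp i (glue n t L) y := by
  induction L generalizing s with
  | nil =>
    obtain ⟨rfl, hs⟩ := h
    refine ⟨hy, ⟨rfl, by rw [D.dim_comp _ _ _ hy]; omega⟩, ?_⟩
    exact (D.one_comp_gt _ _ _ (by rw [hs]; exact hN) hy (by omega)).symm
  | cons A L ih =>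
    have hA := h.right List.mem_cons_self hy hi hd
    obtain ⟨h1, h2, rfl, h4⟩ := h
    have hdA := h2.dim_app (by omega)
    obtain ⟨v1, v2⟩ := Ctx.ract_app h2 (by omega) hA hd hi le_rfl
    obtain ⟨g1, g2, g3⟩ := ih h4 (composable_bd_left D hA (by omega))
    obtain ⟨e1, e2, e3⟩ := h4.glue_spec hN
    refine ⟨g1, ⟨h1, v1, ?_, ?_⟩, ?_⟩
    · simp only [Prod.map, id]
      rw [v2, D.bd_comp_gt _ _ _ _ hA (by omega)]
    · simp only [Prod.map, id]
      rw [v2, D.bd_comp_gt _ _ _ _ hA (by omega)]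
      exact g2
    · rw [List.map_cons, glue, g3, glue]
      simp only [Prod.map, id]
      rw [v2]
      exact (D.distrib_comp _ _ _ _ _ hi hA
        (composable_of_bd (hdA.trans h1) e1 e2.symm)).symm

/-- Left whiskering of paths is injective when it is injective on cells of dimension `≤ n`. -/
theorem map_lact_injective {i : ℕ} {x s' t'' : D.Cell} (h : IsPath n L s t)
    (h' : IsPath n L' s' t'') (hx : D.Composable i x s) (hx' : D.Composable i x s') (hi : i < n)
    (hd : D.dim x = i + 1)
    (hx_can : ∀ y y', D.dim y ≤ n → D.dim y' ≤ n → D.Composable i x y → D.Composable i x y' →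
      D.comp i x y = D.comp i x y' → y = y')
    (e : L.map (Prod.map id (Ctx.lact n i x)) = L'.map (Prod.map id (Ctx.lact n i x))) :
    L = L' := by
  have key : ∀ A ∈ L, ∀ A' ∈ L', Prod.map id (Ctx.lact n i x) A = Prod.map id (Ctx.lact n i x) A' →
      A = A' := by
    intro A hA A' hA' eA
    obtain ⟨m1, m2, _⟩ := h.mem hA
    obtain ⟨m1', m2', _⟩ := h'.mem hA'
    exact Prod.ext (congrArg Prod.fst eA :) (Ctx.lact_injective m2 (by omega) m2' (by omega) hd
      (h.left hA hx hi hd) (h'.left hA' hx' hi hd) hx_can (congrArg Prod.snd eA :))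
  -- The path hypotheses fix the endpoints and would obstruct the induction; `key` retains all that
  -- is needed from them.
  clear h h'
  induction L generalizing L' with
  | nil => cases L' with
    | nil => rfl
    | cons => simp at e
  | cons A L ih => cases L' with
    | nil => simp at e
    | cons A' L' =>
      simp only [List.map_cons, List.cons.injEq] at e
      rw [key A List.mem_cons_self A' List.mem_cons_self e.1, ih e.2 fun B hB B' hB' =>
        key B (List.mem_cons_of_mem _ hB) B' (List.mem_cons_of_mem _ hB')]

end IsPath

end Precategory

/-! ### Normal forms of the new cells of a free extension -/

namespace CellExtension

variable {n : ℕ} {C : Precategory.{u} n} {X : CellExtension C}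

theorem natCast_lt_succ (n : ℕ) : (n : ℕ∞) < ((n + 1 : ℕ) : ℕ∞) := by
  exact_mod_cast Nat.lt_succ_self n

/-- The normal form of a formal composite. -/
noncomputable def Term.nf : ∀ {a b : C.Cell}, X.Term a b → List X.freeExt.Atom
  | _, _, .gen g => [(Sum.inr (New.mk (.gen g)), .triv (Sum.inr (New.mk (.gen g))))]
  | _, _, .one _ _ => []
  | _, _, .comp f g => f.nf ++ g.nf
  | _, _, .lcomp i x _ f => f.nf.map (Prod.map id (.lact n i (Sum.inl x)))
  | _, _, .rcomp i f y _ => f.nf.map (Prod.map id (.ract n i (Sum.inl y)))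

open Precategory

/-- Soundness of the normal form: gluing recovers the cell. It also supplies the validity of the
contexts, without which the context identities could not be used in `Rel.nf_eq`. -/
theorem Term.nf_spec {a b : C.Cell} (f : X.Term a b) :
    IsPath n f.nf (Sum.inl a) (Sum.inl b) ∧
      glue n (Sum.inl b) f.nf = (Sum.inr (New.mk f) : X.freeExt.Cell) := by
  have hN := natCast_lt_succ n
  induction f with
  | gen g =>
    obtain ⟨h1, h2⟩ := Ctx.triv_app (D := X.freeExt) (Sum.inr (New.mk (.gen g))) (k := n)
      (Nat.le_succ n)
    have hp : IsPath (D := X.freeExt) n (Term.gen g : X.Term _ _).nf (Sum.inl (X.bd false g))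
        (Sum.inl (X.bd true g)) := by
      refine ⟨rfl, h1, ?_, ?_, ?_⟩
      · rw [h2]; rfl
      · rw [h2]; rfl
      · rw [h2]; exact X.dim_bd _ _
    refine ⟨hp, ?_⟩
    simp only [Term.nf, glue]
    rw [h2]
    have ht : X.freeExt.dim (Sum.inl (X.bd true g)) = n := X.dim_bd _ _
    have ht' : (X.freeExt.dim (Sum.inl (X.bd true g)) : ℕ∞) < ((n + 1 : ℕ) : ℕ∞) := by
      rw [ht]; exact hN
    -- A one-atom path still glues to the generator followed by an identity, which is removed here.
    refine X.freeExt.comp_one_le _ _ _ ht' ?_ (by rw [ht]; exact le_rfl)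
    refine IsPath.composable_of_bd rfl (by rw [X.freeExt.dim_one _ ht', ht]) ?_
    rw [X.freeExt.bd_one _ _ ht']
    rfl
  | one a ha =>
    refine ⟨⟨rfl, ha⟩, ?_⟩
    change X.extOne (Sum.inl a) = _
    simp [extOne, ha]
  | comp f g ihf ihg =>
    refine ⟨ihf.1.append ihg.1, ?_⟩
    refine (IsPath.glue_append hN ihf.1 ihg.1).trans ?_
    rw [ihf.2, ihg.2]
    exact congrArg Sum.inr (New.comp_mk f g)
  | lcomp i x hx f ih =>
    obtain ⟨hd, hi⟩ := left_lt hx f.par.1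
    obtain ⟨_, h2, h3⟩ := ih.1.map_lact hN (X.composable_inl_inl.2 hx) hi hd
    refine ⟨h2, h3.trans ?_⟩
    rw [ih.2]
    exact congrArg Sum.inr (New.lcomp_mk i x hx f)
  | rcomp i f y hy ih =>
    obtain ⟨hd, hi⟩ := right_lt hy f.par.1
    obtain ⟨_, h2, h3⟩ := ih.1.map_ract hN (X.composable_inl_inl.2 hy) hi hd
    refine ⟨h2, h3.trans ?_⟩
    rw [ih.2]
    exact congrArg Sum.inr (New.rcomp_mk i y hy f)

theorem Term.nf_mem {a b : C.Cell} (f : X.Term a b) {A : X.freeExt.Atom} (hA : A ∈ f.nf) :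
    A.2.Valid A.1 n ∧ n < X.freeExt.dim A.1 := by
  obtain ⟨h1, h2, _⟩ := f.nf_spec.1.mem hA
  exact ⟨h2, by omega⟩

theorem Term.nf_left {a b x : C.Cell} {i : ℕ} (f : X.Term a b) (hx : C.Composable i x a)
    {A : X.freeExt.Atom} (hA : A ∈ f.nf) :
    X.freeExt.Composable i (Sum.inl x) (A.2.app A.1 n) :=
  f.nf_spec.1.left hA (X.composable_inl_inl.2 hx) (left_lt hx f.par.1).2 (left_lt hx f.par.1).1

theorem Term.nf_right {a b y : C.Cell} {i : ℕ} (f : X.Term a b) (hy : C.Composable i a y)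
    {A : X.freeExt.Atom} (hA : A ∈ f.nf) :
    X.freeExt.Composable i (A.2.app A.1 n) (Sum.inl y) :=
  f.nf_spec.1.right hA (X.composable_inl_inl.2 hy) (right_lt hy f.par.1).2 (right_lt hy f.par.1).1

theorem freeExt_one_inl {w : C.Cell} (hw : C.dim w < n) :
    X.freeExt.one (Sum.inl w) = Sum.inl (C.one w) := by
  change X.extOne (Sum.inl w) = _
  simp [extOne, hw.ne]

/-- Normal forms are invariants of cells. The lists carry no source or target in their type, so no
transport is needed even though related terms may have different indices. Axioms on `•_n` become
monoid laws of lists, and whiskering axioms become the context identities. -/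
theorem Rel.nf_eq {a b a' b' : C.Cell} {f : X.Term a b} {f' : X.Term a' b'} (h : X.Rel f f') :
    f.nf = f'.nf := by
  -- The context identities are available only for valid, composable contexts, so the two maps are
  -- compared on the atoms that occur.
  have key : ∀ {L : List X.freeExt.Atom} {F G : X.freeExt.Ctx → X.freeExt.Ctx},
      (∀ A ∈ L, F A.2 = G A.2) → L.map (Prod.map id F) = L.map (Prod.map id G) :=
    fun h => List.map_congr_left fun A hA => Prod.ext rfl (h A hA)
  have key2 : ∀ {L : List X.freeExt.Atom} {F G : X.freeExt.Ctx → X.freeExt.Ctx},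
      (L.map (Prod.map id F)).map (Prod.map id G) = L.map (Prod.map id (G ∘ F)) :=
    by intros; simp
  induction h with
  | refl f => rfl
  | symm _ ih => exact ih.symm
  | trans _ _ ih1 ih2 => exact ih1.trans ih2
  | comp_congr _ _ ih1 ih2 => simp only [Term.nf, ih1, ih2]
  | lcomp_congr _ _ _ _ _ ih => simp only [Term.nf, ih]
  | rcomp_congr _ _ _ _ _ ih => simp only [Term.nf, ih]
  | one_comp => rfl
  | comp_one => simp [Term.nf]
  | assoc => simp [Term.nf]
  | one_lcomp i w hw hx f =>
    have hd := (left_lt hx f.par.1).1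
    have hw' : (C.dim w : ℕ∞) < n := by exact_mod_cast hw
    rw [C.dim_one w hw'] at hd
    simp only [Term.nf]
    refine (key (G := id) fun A hA => ?_).trans (by simp)
    have hm := f.nf_left hx hA
    rw [← freeExt_one_inl hw] at hm ⊢
    exact Ctx.lact_one (f.nf_mem hA).1 (f.nf_mem hA).2 (hw'.trans (natCast_lt_succ n))
      (Nat.succ_injective hd) hm
  | rcomp_one i w hw hy f =>
    have hd := (right_lt hy f.par.1).1
    have hw' : (C.dim w : ℕ∞) < n := by exact_mod_cast hw
    rw [C.dim_one w hw'] at hd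
    simp only [Term.nf]
    refine (key (G := id) fun A hA => ?_).trans (by simp)
    have hm := f.nf_right hy hA
    rw [← freeExt_one_inl hw] at hm ⊢
    exact Ctx.ract_one (f.nf_mem hA).1 (f.nf_mem hA).2 (hw'.trans (natCast_lt_succ n))
      (Nat.succ_injective hd) hm
  | lcomp_one => rfl
  | one_rcomp => rfl
  | lcomp_lcomp i x y hxy hx hy h f =>
    simp only [Term.nf, key2]
    have hdy := (left_lt hy f.par.1).1
    have hdx := (left_lt hx (Term.lcomp i y hy f).par.1).1
    exact key fun A hA => Ctx.lact_comp (D := X.freeExt) (x := Sum.inl x) (y := Sum.inl y)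
      (f.nf_mem hA).1 (f.nf_mem hA).2 hdx hdy (X.composable_inl_inl.2 hxy) (f.nf_left hy hA)
  | rcomp_rcomp i x y hxy hx hy h f =>
    simp only [Term.nf, key2]
    have hdx := (right_lt hx f.par.1).1
    have hdy := (right_lt hy (Term.rcomp i f x hx).par.1).1
    exact key fun A hA => Ctx.ract_comp (D := X.freeExt) (f.nf_mem hA).1 (f.nf_mem hA).2 hdx hdy
      (X.composable_inl_inl.2 hxy) (f.nf_right hx hA)
  | lcomp_rcomp i x y hx hy hx' hy' f =>
    simp only [Term.nf, key2]
    have hdx := (left_lt hx f.par.1).1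
    have hdy := (right_lt hy' f.par.1).1
    exact key fun A hA => Ctx.ract_lact (D := X.freeExt) (f.nf_mem hA).1 (f.nf_mem hA).2 hdx hdy
      (f.nf_left hx hA) (f.nf_right hy' hA)
  | lcomp_comp => simp [Term.nf]
  | comp_rcomp => simp [Term.nf]
  | lcomp_distrib_lcomp i j hij x y hxy hx hy hx' h f =>
    simp only [Term.nf, key2]
    have hdy := (left_lt hy f.par.1).1
    exact key fun A hA => Ctx.lact_lact (D := X.freeExt) hij (f.nf_mem hA).1 (f.nf_mem hA).2 hdy
      (X.composable_inl_inl.2 hxy) (f.nf_left hy hA)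
  | lcomp_distrib_rcomp i j hij x y hxy hx hy hx' h f =>
    simp only [Term.nf, key2]
    have hdx := (left_lt hx' f.par.1).1
    have hdy := (right_lt hy f.par.1).1
    exact key fun A hA => Ctx.lact_ract (D := X.freeExt) hij (f.nf_mem hA).1 (f.nf_mem hA).2 hdx
      hdy (f.nf_left hx' hA) (f.nf_right hy hA)
  | rcomp_distrib_lcomp i j hij x y hxy hx hy hy' h f =>
    simp only [Term.nf, key2]
    have hdx := (left_lt hx f.par.1).1
    exact key fun A hA => Ctx.ract_lact_lt (D := X.freeExt) hij (f.nf_mem hA).1 (f.nf_mem hA).2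
      hdx (X.composable_inl_inl.2 hxy) (f.nf_left hx hA)
  | rcomp_distrib_rcomp i j hij x y hxy hx hy hy' h f =>
    simp only [Term.nf, key2]
    have hdx := (right_lt hx f.par.1).1
    have hdy := (right_lt hy' f.par.1).1
    exact key fun A hA => Ctx.ract_ract (D := X.freeExt) hij (f.nf_mem hA).1 (f.nf_mem hA).2 hdx
      hdy (f.nf_right hy' hA) (f.nf_right hx hA)

/-- Both cells are obtained by gluing the same list at the same target. -/
theorem New.mk_eq_of_nf_eq {a b a' b' : C.Cell} {f : X.Term a b} {f' : X.Term a' b'}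
    (hb : b = b') (h : f.nf = f'.nf) : New.mk f = New.mk f' := by
  apply Sum.inr_injective (α := C.Cell)
  rw [← f.nf_spec.2, ← f'.nf_spec.2, h]
  exact congrArg (fun t : C.Cell => glue (D := X.freeExt) n (Sum.inl t) f'.nf) hb

end CellExtension

/-! ### Left cancellation in a free extension -/

/-- Composition on the left with a fixed cell is injective. -/
def Precategory.LeftCancel {N : ℕ∞} (C : Precategory.{u} N) : Prop :=
  ∀ ⦃i : ℕ⦄ ⦃x y y' : C.Cell⦄, C.Composable i x y → C.Composable i x y' →
    C.comp i x y = C.comp i x y' → y = y'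

namespace CellExtension

variable {n : ℕ} {C : Precategory.{u} n} (X : CellExtension C)

/-- The inductive step, by cases on which cells are old (`inl`) and which are new (`inr`). -/
theorem leftCancel_freeExt (hC : C.LeftCancel) : X.freeExt.LeftCancel := by
  rintro i (x | p) y y' h h' e
  · rcases y with y | q <;> rcases y' with y' | q'
    · exact congrArg Sum.inl
        (hC (X.composable_inl_inl.1 h) (X.composable_inl_inl.1 h') (Sum.inl_injective e))
    · exact (Sum.inl_ne_inr e).elim
    · exact (Sum.inr_ne_inl e).elim
    · replace e : New.lcomp i x q = New.lcomp i x q' := Sum.inr_injective e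
      replace h : C.Composable i x (q.bd false) := X.composable_inl_inr.1 h
      replace h' : C.Composable i x (q'.bd false) := X.composable_inl_inr.1 h'
      refine congrArg Sum.inr ?_
      induction q using New.ind with
      | h a b f =>
        induction q' using New.ind with
        | h a' b' f' =>
          replace h : C.Composable i x a := h
          replace h' : C.Composable i x a' := h'
          rw [New.lcomp_mk i x h, New.lcomp_mk i x h'] at e
          replace e := New.exact e
          obtain ⟨hd, hi⟩ := left_lt h f.par.1
          -- The targets of the two whiskered cells agree, so cancelling `x` in `C` identifies the
          -- targets `b` and `b'`.
          refine New.mk_eq_of_nf_eq (hC (f.par.left h) (f'.par.left h') e.bd_eq.2) ?_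
          refine f.nf_spec.1.map_lact_injective f'.nf_spec.1 (X.composable_inl_inl.2 h)
            (X.composable_inl_inl.2 h') hi hd ?_ e.nf_eq
          -- Cells of dimension at most `n` are old, so the cancellation required on whiskers is the
          -- one assumed in `C`.
          rintro (y | q) (y' | q') dy dy' hy hy' ey
          · exact congrArg Sum.inl
              (hC (X.composable_inl_inl.1 hy) (X.composable_inl_inl.1 hy') (Sum.inl_injective ey))
          · exact absurd dy' (Nat.not_succ_le_self n)
          · exact absurd dy (Nat.not_succ_le_self n)
          · exact absurd dy (Nat.not_succ_le_self n)
  · rcases y with y | q <;> rcases y' with y' | q'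
    · have hy := X.composable_inr_inl.1 h
      have hy' := X.composable_inr_inl.1 h'
      replace e : New.rcomp i p y = New.rcomp i p y' := Sum.inr_injective e
      refine congrArg Sum.inl ?_
      induction p using New.ind with
      | h a b f =>
        replace hy : C.Composable i a y := hy
        replace hy' : C.Composable i a y' := hy'
        rw [New.rcomp_mk i y hy, New.rcomp_mk i y' hy'] at e
        -- Taking sources turns the equation into one between `n`-cells of `C`, with the same `y`
        -- and `y'`.
        exact hC hy hy' (New.exact e).bd_eq.1
    -- An old right factor forces `i < n`, a new one forces `i = n`.
    · have h1 := right_lt (X.composable_inr_inl.1 h) p.par.1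
      have h2 := X.composable_inr_inr.1 h'
      omega
    · have h1 := right_lt (X.composable_inr_inl.1 h') p.par.1
      have h2 := X.composable_inr_inr.1 h
      omega
    · replace h := (X.composable_inr_inr.1 h).2
      replace h' := (X.composable_inr_inr.1 h').2
      replace e : New.comp p q = New.comp p q' := Sum.inr_injective e
      refine congrArg Sum.inr ?_
      induction p using New.ind with
      | h a b f =>
        induction q using New.ind with
        | h b₁ c g =>
          induction q' using New.ind with
          | h b₂ c' g' =>
            obtain rfl : b = b₁ := h
            obtain rfl : b = b₂ := h'
            rw [New.comp_mk, New.comp_mk] at e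
            replace e := New.exact e
            -- The two normal forms share the prefix `f.nf`.
            exact New.mk_eq_of_nf_eq e.bd_eq.2 (List.append_cancel_left e.nf_eq)

end CellExtension

/-! ### From free extensions to polygraphs and to the union -/

theorem Polygraph.leftCancel_free : ∀ {n : ℕ} (P : Polygraph.{u} n), P.free.LeftCancel
  -- Composable cells have positive dimension, so a `0`-precategory has none.
  | 0, _ => fun _ _ _ _ h => absurd h.1 (Nat.succ_ne_zero _).symm
  | _ + 1, P => P.gens.leftCancel_freeExt P.trunc.leftCancel_free

theorem PrecatSeq.leftCancel_colim (S : PrecatSeq.{u}) (hS : ∀ n, (S.obj n).LeftCancel) :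
    S.colim.LeftCancel := by
  intro i x y y' h h' e
  obtain ⟨n, a, b, b', rfl, rfl, rfl⟩ := exists_mk₃ x y y'
  obtain ⟨N, hN, hc⟩ := S.colim_composable h
  obtain ⟨N', hN', hc'⟩ := S.colim_composable h'
  -- The two composabilities in the union may appear at different stages; the maximum realises both.
  have h1 := hc (max N N') (le_max_left _ _) (hN.trans (le_max_left _ _))
  have h2 := hc' (max N N') (le_max_right _ _) (hN.trans (le_max_left _ _))
  have hle : n ≤ max N N' := hN.trans (le_max_left _ _)
  replace e : S.colimComp i (ofStage a) (ofStage b) = S.colimComp i (ofStage a) (ofStage b') := e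
  rw [← mk_up hle a, ← mk_up hle b, ← mk_up hle b', S.colimComp_mk h1, S.colimComp_mk h2] at e
  -- The composites may become equal only at a later stage `k`, and cancellation is applied there.
  obtain ⟨k, hk, _, e⟩ := mk_eq.1 e
  rw [PrecatHom.comp_map _ _ _ _ h1, PrecatHom.comp_map _ _ _ _ h2] at e
  have e' := hS k (PrecatHom.composable_map _ h1) (PrecatHom.composable_map _ h2) e
  rw [S.up_up, S.up_up] at e'
  exact mk_eq.2 ⟨k, _, _, e'⟩

theorem mainTheorem9 (P : OmegaPolygraph.{u}) (i : ℕ) (x y₁ y₂ : P.free.Cell)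
    (h₁ : P.free.Composable i x y₁) (h₂ : P.free.Composable i x y₂)
    (h : P.free.comp i x y₁ = P.free.comp i x y₂) : y₁ = y₂ :=
  P.freeSeq.leftCancel_colim (fun n => (P.poly n).leftCancel_free) h₁ h₂ h
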